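/- Let $\alpha\ge\beta\ge-\frac12$ be real numbers with $\alpha>-\frac12$, and put $\rho:=\alpha+\beta+1$. For $\mu\in\mathbb C$ and $t\ge0$ let $$\varphi_\mu^{(\alpha,\beta)}(t):={}_2F_1\Bigl(\tfrac{\alpha+\beta+1-i\mu}{2},\tfrac{\alpha+\beta+1+i\mu}{2};\alpha+1;-\sinh^2 t\Bigr)$$ be the Jacobi function, where ${}_2F_1(a,b;c;\cdot)$ is the Gauss hypergeometric function, that is, the analytic continuation of the Gauss series from $(-1,1)$ to $(-\infty,1)$. Then for every $t\ge0$ the function $s\mapsto\varphi_{i\rho+is}^{(\alpha,\beta)}(t)$ of the real variable $s$ is differentiable at $0$, so that the first moment function $$m_1(t):=\frac{\partial}{\partial s}\varphi_{i\rho+is}^{(\alpha,\beta)}(t)\Big|_{s=0}$$ is well defined, and there is a constant $C=C(\alpha,\beta)$ such that for all $t\ge0$ and all $\lambda\in\mathbb R$, $$\bigl|\varphi_{i\rho-\lambda}^{(\alpha,\beta)}(t)-e^{i\lambda m_1(t)}\bigr|\le C\,(\lambda^2+|\lambda|^3).$$ -/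

import Mathlib

namespace Hyp

open Polynomial
open scoped Nat

theorem poch_add (a : ℂ) (n m : ℕ) :
    (ascPochhammer ℂ n).eval a * (ascPochhammer ℂ m).eval (a + n)
      = (ascPochhammer ℂ (n + m)).eval a := by
  rw [← ascPochhammer_mul]; simp

theorem poch_succ_left (a : ℂ) (n : ℕ) :
    (ascPochhammer ℂ (n + 1)).eval a = a * (ascPochhammer ℂ n).eval (a + 1) := by
  rw [ascPochhammer_succ_left]; simp

theorem poch_ne_zero {c : ℂ} (hc : ∀ k : ℕ, c ≠ -k) (n : ℕ) :
    (ascPochhammer ℂ n).eval c ≠ 0 := by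
  rw [Ne, ascPochhammer_eval_eq_zero_iff]
  rintro ⟨k, -, h⟩
  exact hc k (by rw [h]; ring)

theorem chu (b : ℂ) (N : ℕ) : ∀ {c : ℂ}, (∀ k : ℕ, c ≠ -k) →
    ∑ n ∈ Finset.range (N + 1), (-1 : ℂ) ^ n * (N.choose n : ℂ) *
      ((ascPochhammer ℂ n).eval (c - b) / (ascPochhammer ℂ n).eval c)
      = (ascPochhammer ℂ N).eval b / (ascPochhammer ℂ N).eval c := by
  induction N with
  | zero => intro c _; simp
  | succ N ih =>
    intro c hc
    have hc1 : ∀ k : ℕ, c + 1 ≠ -k := fun k h => hc (k + 1) (by push_cast; linear_combination h)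
    have hc0 : c ≠ 0 := by simpa using hc 0
    have e1 := ih hc
    have e2 := ih hc1
    have h1 : ∑ n ∈ Finset.range (N + 1 + 1), (-1 : ℂ) ^ n * ((N + 1).choose n : ℂ) *
        ((ascPochhammer ℂ n).eval (c - b) / (ascPochhammer ℂ n).eval c)
        = (∑ n ∈ Finset.range (N + 1), (-1 : ℂ) ^ n * (N.choose n : ℂ) *
      ((ascPochhammer ℂ n).eval (c - b) / (ascPochhammer ℂ n).eval c))
       - (c - b) / c * ∑ n ∈ Finset.range (N + 1), (-1 : ℂ) ^ n * (N.choose n : ℂ) *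
      ((ascPochhammer ℂ n).eval (c + 1 - b) / (ascPochhammer ℂ n).eval (c + 1)) := by
      have h2 : (∑ n ∈ Finset.range (N + 1), (-1 : ℂ) ^ n * (N.choose n : ℂ) *
        ((ascPochhammer ℂ n).eval (c - b) / (ascPochhammer ℂ n).eval c))
        = ∑ n ∈ Finset.range (N + 1 + 1), (-1 : ℂ) ^ n * (N.choose n : ℂ) *
        ((ascPochhammer ℂ n).eval (c - b) / (ascPochhammer ℂ n).eval c) := by
        rw [Finset.sum_range_succ _ (N + 1)]; simp
      rw [h2, Finset.sum_range_succ', Finset.sum_range_succ' _ (N + 1), Finset.mul_sum,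
        add_sub_right_comm, ← Finset.sum_sub_distrib]
      congr 1
      · apply Finset.sum_congr rfl
        intro n _
        rw [Nat.choose_succ_succ, poch_succ_left, poch_succ_left c]
        rw [show c - b + 1 = c + 1 - b by ring]
        have := poch_ne_zero hc1 n
        push_cast
        field_simp
        ring
      · simp
    rw [h1, e1, e2, ascPochhammer_succ_eval]
    have h3 : (ascPochhammer ℂ N).eval c * (c + N) = c * (ascPochhammer ℂ N).eval (c + 1) := by
      rw [← poch_succ_left, ascPochhammer_succ_eval]
    have h4 := poch_ne_zero hc1 N
    have h5 := poch_ne_zero hc N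
    have h6 : c + N ≠ 0 := fun h => hc N (by linear_combination h)
    rw [ascPochhammer_succ_eval]
    have h7 : (ascPochhammer ℂ N).eval (c + 1) = (ascPochhammer ℂ N).eval c * (c + N) / c := by
      rw [h3]; field_simp
    rw [h7]
    field_simp
    ring

theorem norm_poch_le (a : ℂ) (s : ℝ) (h : ‖a‖ ≤ s) (m : ℕ) :
    ‖(ascPochhammer ℂ m).eval a‖ ≤ (ascPochhammer ℝ m).eval s := by
  induction m with
  | zero => simp
  | succ m ih =>
    rw [ascPochhammer_succ_eval, ascPochhammer_succ_eval, norm_mul]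
    have h2 : ‖a + m‖ ≤ s + m := (norm_add_le _ _).trans (by simpa using h)
    exact mul_le_mul ih h2 (norm_nonneg _) ((norm_nonneg _).trans ih)

theorem choose_eq_poch {K : Type*} [Field K] [CharZero K] (a : K) (n : ℕ) :
    Ring.choose (a + n - 1) n = (n ! : K)⁻¹ * (ascPochhammer K n).eval a := by
  have h := Ring.factorial_nsmul_multichoose_eq_ascPochhammer a n
  rw [Polynomial.ascPochhammer_smeval_eq_eval] at h
  rw [Ring.choose, show a + n - 1 - n + 1 = a by ring, ← h]
  have : (n ! : K) ≠ 0 := by exact_mod_cast n.factorial_ne_zero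
  rw [nsmul_eq_mul]
  field_simp

theorem binom (a z : ℂ) (hz : ‖z‖ < 1) :
    HasSum (fun m : ℕ => (m ! : ℂ)⁻¹ * (ascPochhammer ℂ m).eval a * z ^ m) ((1 - z) ^ (-a)) := by
  have h := (Complex.one_div_one_sub_cpow_hasFPowerSeriesOnBall_zero a).hasSum (y := z)
    (by simpa [enorm_eq_nnnorm] using! hz)
  simpa [FormalMultilinearSeries.ofScalars_apply_eq, choose_eq_poch, Complex.cpow_neg, mul_comm] using h

theorem binom_real (a z : ℝ) (hz : |z| < 1) :
    HasSum (fun m : ℕ => (m ! : ℝ)⁻¹ * (ascPochhammer ℝ m).eval a * z ^ m) ((1 - z) ^ (-a)) := by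
  have h := (Real.one_div_one_sub_rpow_hasFPowerSeriesOnBall_zero a).hasSum (y := z)
    (by simpa [enorm_eq_nnnorm] using! hz)
  have h1 : 0 ≤ 1 - z := by linarith [(abs_lt.1 hz).2]
  simpa [FormalMultilinearSeries.ofScalars_apply_eq, choose_eq_poch, Real.rpow_neg h1, mul_comm] using h

theorem radius_ge (a b c : ℂ) : 1 ≤ (ordinaryHypergeometricSeries ℂ a b c).radius := by
  by_cases h : ∀ n : ℕ, (n : ℂ) ≠ -a ∧ (n : ℂ) ≠ -b ∧ (n : ℂ) ≠ -c
  · rw [ordinaryHypergeometricSeries_radius_eq_one _ _ _ _ h]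
  · push Not at h
    obtain ⟨n, hn⟩ := h
    have : (ordinaryHypergeometricSeries ℂ a b c).radius = ⊤ := by
      apply FormalMultilinearSeries.radius_eq_top_of_forall_image_add_eq_zero _ (n + 1)
      intro m
      apply ordinaryHypergeometricSeries_eq_zero_of_neg_nat (k := n)
      · tauto
      · omega
    simp [this]

theorem summable_norm_coeff (a b c z : ℂ) (hz : ‖z‖ < 1) :
    Summable fun n : ℕ => ‖((n ! : ℂ)⁻¹ * (ascPochhammer ℂ n).eval a * (ascPochhammer ℂ n).eval b *
      ((ascPochhammer ℂ n).eval c)⁻¹) * z ^ n‖ := by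
  have h := (ordinaryHypergeometricSeries ℂ a b c).summable_norm_apply (x := z) (by
    have : z ∈ Metric.eball (0:ℂ) 1 := by simpa [enorm_eq_nnnorm] using! hz
    exact Metric.eball_subset_eball (radius_ge a b c) this)
  simpa only [ordinaryHypergeometricSeries_apply_eq, smul_eq_mul] using h

theorem analyticAt_hyp (a b c z : ℂ) (hz : ‖z‖ < 1) :
    AnalyticAt ℂ (ordinaryHypergeometric a b c : ℂ → ℂ) z := by
  have h0 : 0 < (ordinaryHypergeometricSeries ℂ a b c).radius :=
    lt_of_lt_of_le one_pos (radius_ge a b c)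
  have := (ordinaryHypergeometricSeries ℂ a b c).hasFPowerSeriesOnBall h0
  apply this.analyticAt_of_mem
  have : z ∈ Metric.eball (0:ℂ) 1 := by simpa [enorm_eq_nnnorm] using! hz
  exact Metric.eball_subset_eball (radius_ge a b c) this


theorem coeff_sum (a b : ℂ) {c : ℂ} (hc : ∀ k : ℕ, c ≠ -k) (N : ℕ) :
    ∑ p ∈ Finset.HasAntidiagonal.antidiagonal N,
      ((p.1 ! : ℂ)⁻¹ * (ascPochhammer ℂ p.1).eval a * (ascPochhammer ℂ p.1).eval (c - b) *
      ((ascPochhammer ℂ p.1).eval c)⁻¹) * (-1) ^ p.1 *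
      ((p.2 ! : ℂ)⁻¹ * (ascPochhammer ℂ p.2).eval (a + p.1))
      = (N ! : ℂ)⁻¹ * (ascPochhammer ℂ N).eval a * (ascPochhammer ℂ N).eval b *
      ((ascPochhammer ℂ N).eval c)⁻¹ := by
  have h := chu b N hc
  rw [mul_assoc _ _ (_)⁻¹, ← div_eq_mul_inv ((ascPochhammer ℂ N).eval b), ← h, Finset.mul_sum,
    Finset.Nat.sum_antidiagonal_eq_sum_range_succ_mk]
  apply Finset.sum_congr rfl
  intro n hn
  have hn' : n ≤ N := by simpa [Nat.lt_succ_iff] using hn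
  have e := poch_add a n (N - n)
  rw [Nat.add_sub_cancel' hn'] at e
  rw [← e, Nat.cast_choose ℂ hn']
  have f1 : (n ! : ℂ) ≠ 0 := by exact_mod_cast n.factorial_ne_zero
  have f2 : (N ! : ℂ) ≠ 0 := by exact_mod_cast N.factorial_ne_zero
  have f3 : ((N - n)! : ℂ) ≠ 0 := by exact_mod_cast (N - n).factorial_ne_zero
  have f4 := poch_ne_zero hc n
  field_simp

theorem pfaff_near_zero (a b : ℂ) {c : ℂ} (hc : ∀ k : ℕ, c ≠ -k) {x : ℝ} (hx : |x| < 1 / 3) :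
    (1 - (x : ℂ)) ^ (-a) * ordinaryHypergeometric a (c - b) c ((x : ℂ) / (x - 1))
      = ordinaryHypergeometric a b c (x : ℂ) := by
  set A : ℕ → ℂ := fun n => (n ! : ℂ)⁻¹ * (ascPochhammer ℂ n).eval a *
    (ascPochhammer ℂ n).eval (c - b) * ((ascPochhammer ℂ n).eval c)⁻¹ with hA
  set B : ℕ → ℕ → ℂ := fun n m => (m ! : ℂ)⁻¹ * (ascPochhammer ℂ m).eval (a + n) with hB
  set f : ℕ × ℕ → ℂ := fun p => A p.1 * (-1) ^ p.1 * B p.1 p.2 * (x : ℂ) ^ (p.1 + p.2) with hf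
  have hx1 : ‖(x : ℂ)‖ < 1 := by rw [Complex.norm_real, Real.norm_eq_abs]; linarith
  have hxn : (1 : ℂ) - x ≠ 0 := by
    intro h
    have : (x : ℂ) = 1 := by linear_combination -h
    rw [this] at hx1; simp at hx1
  set r := |x| with hr
  have hr0 : 0 ≤ r := abs_nonneg x
  have hrr : |r| < 1 := by rw [abs_of_nonneg hr0]; linarith
  have inner (n : ℕ) : HasSum (fun m => f (n, m))
      (A n * (-1) ^ n * (x : ℂ) ^ n * (1 - (x : ℂ)) ^ (-(a + n))) := by
    have h := (binom (a + n) x hx1).mul_left (A n * (-1) ^ n * (x : ℂ) ^ n)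
    have e : (fun m => f (n, m)) = fun m : ℕ => A n * (-1) ^ n * (x : ℂ) ^ n *
        ((m ! : ℂ)⁻¹ * (ascPochhammer ℂ m).eval (a + n) * (x : ℂ) ^ m) := by
      funext m
      simp only [hf, hB, pow_add]
      ring
    rw [e]
    exact h
  have hval (n : ℕ) : A n * (-1) ^ n * (x : ℂ) ^ n * (1 - (x : ℂ)) ^ (-(a + n))
      = (1 - (x : ℂ)) ^ (-a) * (A n * ((x : ℂ) / (x - 1)) ^ n) := by
    rw [neg_add, ← sub_eq_add_neg, Complex.cpow_sub _ _ hxn, Complex.cpow_natCast,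
      show (x : ℂ) - 1 = -(1 - x) by ring, div_pow, neg_pow (1 - (x : ℂ))]
    have : ((-1 : ℂ) ^ n) * (-1) ^ n = 1 := by rw [← mul_pow]; simp
    have h2 : (-1 : ℂ) ^ n ≠ 0 := by simp
    generalize A n = q
    generalize (-1 : ℂ) ^ n = e at this h2
    generalize (1 - (x : ℂ)) ^ (-a) = w
    have h3 : (1 - (x : ℂ)) ^ n ≠ 0 := pow_ne_zero _ hxn
    generalize (1 - (x : ℂ)) ^ n = u at h3
    field_simp
    linear_combination (q * (x : ℂ) ^ n * w) * this
  have hinnerbd (n : ℕ) : HasSum (fun m : ℕ => ‖A n‖ * r ^ n * ((m ! : ℝ)⁻¹ *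
      (ascPochhammer ℝ m).eval (‖a‖ + n) * r ^ m))
      (‖A n‖ * r ^ n * (1 - r) ^ (-(‖a‖ + n))) :=
    (binom_real (‖a‖ + n) r hrr).mul_left _
  have hle (n m : ℕ) : ‖f (n, m)‖ ≤ ‖A n‖ * r ^ n * ((m ! : ℝ)⁻¹ *
      (ascPochhammer ℝ m).eval (‖a‖ + n) * r ^ m) := by
    have h := norm_poch_le (a + n) (‖a‖ + n) ((norm_add_le _ _).trans (by simp)) m
    simp only [hf, hB, norm_mul, norm_pow, norm_neg, norm_one, one_pow, mul_one,
      Complex.norm_real, Real.norm_eq_abs, norm_inv, Complex.norm_natCast, pow_add, ← hr]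
    have : 0 ≤ ‖A n‖ * r ^ n * ((m ! : ℝ)⁻¹ * r ^ m) := by positivity
    nlinarith [mul_le_mul_of_nonneg_left h this]
  have hsum : Summable f := by
    apply Summable.of_norm
    rw [summable_prod_of_nonneg (fun _ => norm_nonneg _)]
    have s1 (n : ℕ) : Summable fun m => ‖f (n, m)‖ :=
      Summable.of_nonneg_of_le (fun _ => norm_nonneg _) (hle n) (hinnerbd n).summable
    refine ⟨s1, ?_⟩
    have hy : ‖((r / (1 - r) : ℝ) : ℂ)‖ < 1 := by
      rw [Complex.norm_real, Real.norm_eq_abs, abs_of_nonneg (div_nonneg hr0 (by linarith)),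
        div_lt_one (by linarith)]
      linarith
    have s2 := (summable_norm_coeff a (c - b) c _ hy).mul_left ((1 - r) ^ (-‖a‖))
    refine Summable.of_nonneg_of_le (fun n => tsum_nonneg fun _ => norm_nonneg _) (fun n => ?_) s2
    refine ((s1 n).tsum_le_tsum (hle n) (hinnerbd n).summable).trans ?_
    rw [(hinnerbd n).tsum_eq]
    have h1r : 0 < 1 - r := by linarith
    change _ ≤ (1 - r) ^ (-‖a‖) * ‖A n * _‖
    rw [norm_mul (A n)]
    generalize ‖A n‖ = q
    rw [neg_add, ← sub_eq_add_neg, Real.rpow_sub h1r, Real.rpow_natCast, norm_pow,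
      Complex.norm_real, Real.norm_eq_abs, abs_of_nonneg (div_nonneg hr0 h1r.le), div_pow]
    apply le_of_eq
    field_simp
  have t1 : HasSum (fun n => A n * (-1) ^ n * (x : ℂ) ^ n * (1 - (x : ℂ)) ^ (-(a + n)))
      (∑' p, f p) := hsum.hasSum.prod_fiberwise inner
  have t2 : (∑' p, f p) = (1 - (x : ℂ)) ^ (-a) *
      ordinaryHypergeometric a (c - b) c ((x : ℂ) / (x - 1)) := by
    rw [← t1.tsum_eq, ordinaryHypergeometric_eq_tsum]
    simp only [smul_eq_mul]
    rw [← tsum_mul_left]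
    exact tsum_congr hval
  rw [← t2, ← Finset.HasAntidiagonal.sigmaAntidiagonalEquivProd.tsum_eq,
    Summable.tsum_sigma' (f := fun q => f (Finset.HasAntidiagonal.sigmaAntidiagonalEquivProd q))
      (fun n => (hasSum_fintype _).summable)
      (Finset.HasAntidiagonal.sigmaAntidiagonalEquivProd.summable_iff.mpr hsum),
    ordinaryHypergeometric_eq_tsum]
  refine tsum_congr fun N => ?_
  rw [tsum_fintype, ← coeff_sum a b hc N, smul_eq_mul, Finset.sum_mul]
  refine (Finset.sum_coe_sort (Finset.HasAntidiagonal.antidiagonal N) f).trans ?_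
  refine Finset.sum_congr rfl fun p hp => ?_
  have hp := Finset.HasAntidiagonal.mem_antidiagonal.1 hp
  simp only [hf, hA, hB, hp]

theorem exists_continuation (a b : ℂ) {c : ℂ} (hc : ∀ k : ℕ, c ≠ -k) :
    ∃ f : ℝ → ℂ, AnalyticOnNhd ℝ f (Set.Iio 1) ∧
      ∀ x : ℝ, |x| < 1 → f x = ordinaryHypergeometric a b c (x : ℂ) := by
  classical
  set P : ℝ → ℂ := fun x =>
    (1 - (x : ℂ)) ^ (-a) * ordinaryHypergeometric a (c - b) c ((x : ℂ) / (x - 1)) with hP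
  set S : ℝ → ℂ := fun x => ordinaryHypergeometric a b c (x : ℂ) with hS
  have hof (x : ℝ) : AnalyticAt ℝ (fun x : ℝ => (x : ℂ)) x := Complex.ofRealCLM.analyticAt x
  have anS : AnalyticOnNhd ℝ S (Set.Ioo (-1) 1) := by
    intro x hx
    have h := (analyticAt_hyp a b c (x : ℂ) (by
      rw [Complex.norm_real, Real.norm_eq_abs]; exact abs_lt.2 hx)).restrictScalars (𝕜 := ℝ)
    exact h.fun_comp (hof x)
  have anP : AnalyticOnNhd ℝ P (Set.Iio (1 / 2)) := by
    intro x hx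
    have hx : x < 1 / 2 := hx
    have h1 : (x : ℂ) - 1 ≠ 0 := by
      intro h
      have h' : x - 1 = 0 := by exact_mod_cast h
      linarith
    have h2 : ‖(x : ℂ) / (x - 1)‖ < 1 := by
      have h0 : x / (x - 1) = (x : ℝ) / (x - 1) := rfl
      have : (x : ℂ) / (x - 1) = ((x / (x - 1) : ℝ) : ℂ) := by push_cast; rfl
      rw [this, Complex.norm_real, Real.norm_eq_abs, abs_div, div_lt_one (by
        rw [abs_pos]; intro h; linarith), abs_of_neg (show x - 1 < 0 by linarith), abs_lt]
      constructor <;> linarith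
    have g := (analyticAt_hyp a (c - b) c _ h2).restrictScalars (𝕜 := ℝ)
    have g2 : AnalyticAt ℝ (fun x : ℝ => (x : ℂ) / (x - 1)) x :=
      (hof x).div ((hof x).sub analyticAt_const) h1
    have g3 : AnalyticAt ℂ (fun z : ℂ => (1 - z) ^ (-a)) (x : ℂ) := by
      apply AnalyticAt.cpow (analyticAt_const.sub analyticAt_id) analyticAt_const
      left
      simp; linarith
    exact ((g3.restrictScalars (𝕜 := ℝ)).fun_comp (hof x)).mul (AnalyticAt.fun_comp (f := fun x : ℝ => (x : ℂ) / (x - 1)) g g2)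
  have agree : Set.EqOn P S (Set.Ioo (-1) (1 / 2)) := by
    apply AnalyticOnNhd.eqOn_of_preconnected_of_eventuallyEq (𝕜 := ℝ)
      (anP.mono fun x hx => hx.2) (anS.mono fun x hx => ⟨hx.1, hx.2.trans (by norm_num)⟩)
      isPreconnected_Ioo (z₀ := 0) (by norm_num)
    filter_upwards [Ioo_mem_nhds (show (-(1 / 3) : ℝ) < 0 by norm_num)
      (show (0 : ℝ) < 1 / 3 by norm_num)] with x hx
    exact pfaff_near_zero a b hc (abs_lt.2 hx)
  refine ⟨fun x => if x < 1 / 2 then P x else S x, ?_, ?_⟩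
  · intro x hx
    by_cases h : x < 1 / 2
    · refine (anP x h).congr ?_
      filter_upwards [Iio_mem_nhds h] with y hy
      exact (if_pos hy).symm
    · have hx : x < 1 := hx
      refine (anS x ⟨by linarith, hx⟩).congr ?_
      filter_upwards [Ioi_mem_nhds (show -1 < x by linarith)] with y hy
      split_ifs with h'
      · exact (agree ⟨hy, h'⟩).symm
      · rfl
  · intro x hx
    have hx := abs_lt.1 hx
    by_cases h : x < 1 / 2
    · simp only [if_pos h]; exact agree ⟨hx.1, h⟩
    · simp only [if_neg h]; rfl

theorem eq_of_continuation {F f g : ℝ → ℂ} (hf : AnalyticOnNhd ℝ f (Set.Iio 1))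
    (hg : AnalyticOnNhd ℝ g (Set.Iio 1)) (h1 : ∀ x : ℝ, |x| < 1 → f x = F x)
    (h2 : ∀ x : ℝ, |x| < 1 → g x = F x) {x : ℝ} (hx : x < 1) : f x = g x := by
  refine AnalyticOnNhd.eqOn_of_preconnected_of_eventuallyEq (𝕜 := ℝ) hf hg
    isPreconnected_Iio (z₀ := 0) (by simp) ?_ hx
  filter_upwards [Ioo_mem_nhds (show (-1 : ℝ) < 0 by norm_num) one_pos] with y hy
  rw [h1 y (abs_lt.2 hy), h2 y (abs_lt.2 hy)]

end Hyp

open Classical in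
/-- Gauss' hypergeometric function `₂F₁(a, b; c; x)` for real `x < 1` (with `c ∉ {0, -1, -2, …}`):
the real-analytic continuation to `(-∞, 1)` of the Gauss series, which converges for `|x| < 1`.
It exists (`Hyp.exists_continuation`) and is unique on `(-∞, 1)` (`Hyp.eq_of_continuation`). On
`(-∞, 1)` it is the restriction of the principal branch on `ℂ ∖ [1, ∞)`. -/
noncomputable def gauss2F1 (a b c : ℂ) (x : ℝ) : ℂ :=
  if h : ∃ f : ℝ → ℂ, AnalyticOnNhd ℝ f (Set.Iio 1) ∧
      ∀ y : ℝ, |y| < 1 → f y = ordinaryHypergeometric a b c (y : ℂ)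
  then h.choose x else ordinaryHypergeometric a b c (x : ℂ)

theorem gauss2F1_analytic (a b : ℂ) {c : ℂ} (hc : ∀ k : ℕ, c ≠ -k) :
    AnalyticOnNhd ℝ (gauss2F1 a b c) (Set.Iio 1) := by
  have h := Hyp.exists_continuation a b hc
  have e : gauss2F1 a b c = h.choose := by
    funext x; rw [gauss2F1, dif_pos h]
  rw [e]
  exact h.choose_spec.1

theorem gauss2F1_eq_series (a b : ℂ) {c : ℂ} (hc : ∀ k : ℕ, c ≠ -k) {x : ℝ} (hx : |x| < 1) :
    gauss2F1 a b c x = ordinaryHypergeometric a b c (x : ℂ) := by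
  have h := Hyp.exists_continuation a b hc
  rw [gauss2F1, dif_pos h]
  exact h.choose_spec.2 x hx

/-- The Jacobi function `φ_μ^{(α,β)}(t) =
₂F₁((α + β + 1 - iμ)/2, (α + β + 1 + iμ)/2; α + 1; -sinh² t)`, for complex `μ`. -/
noncomputable def jacobiFunction (α β : ℝ) (μ : ℂ) (t : ℝ) : ℂ :=
  gauss2F1 ((α + β + 1 - Complex.I * μ) / 2) ((α + β + 1 + Complex.I * μ) / 2) (α + 1)
    (-(Real.sinh t) ^ 2)

/-- The parameter `ρ = α + β + 1`. -/
def jacobiRho (α β : ℝ) : ℝ := α + β + 1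

/-- The moment function `m_k(t) = ∂^k/∂s^k φ_{iρ + is}^{(α,β)}(t)` at `s = 0`, where `s` is real.
(Its values are real numbers, regarded here as complex numbers.) -/
noncomputable def momentFunction (α β : ℝ) (k : ℕ) (t : ℝ) : ℂ :=
  iteratedDeriv k
    (fun s : ℝ => jacobiFunction α β (Complex.I * jacobiRho α β + Complex.I * s) t) 0

/-! Pfaff's transformation writes `φ_{iρ+iz}(t)` as `exp(z log cosh t) · F_y(z)`, where `y = tanh² t
∈ [0,1)` and `F_y(z) = ₂F₁(-z/2, -β - z/2; α+1; y)` (`jacobiFunction_eq_exp_mul_hyp`). Since `F_y(0)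
= 1`, the first moment is `log cosh t + D` with `D = F_y'(0)`, a real number. At `z = iλ` the
unbounded phase `exp(iλ log cosh t)` is common to both terms and has modulus one, so the claim
becomes a bound for `F_y(iλ) - exp(iλD)`, uniform in `y`.

Small `|λ|`: as `|β| < α + 1`, the series for `F_y` still converges at `y = 1` when `z` is near `0`.
Hence `F_y` is holomorphic and bounded on a disc, with radius and bound independent of `y`, and the
Schwarz lemma gives `F_y(z) = 1 + Dz + O(|z|²)` uniformly. Subtracting the expansion of `exp(iλD)`
leaves `O(λ²)`.

Large `|λ|`: `exp(iλD)` has modulus one, so it is enough that `|F_y(iλ)| = |φ_{iρ-λ}(t)|` grows at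
most linearly in `|λ|`. The Jacobi equation has a decreasing energy (`antitoneOn_energy`) that
dominates `λ²|φ|²`. It is evaluated at a point `s` with `tanh s` of order `1/|λ|`, where the power
series controls `φ` and `φ'`; before `s` the series bounds `φ` directly. Both regimes give a
multiple of `λ²`, so the cubic term is only slack. -/

/-! ### The Gauss series: derivative, differential equation, Pfaff's transformation. -/

namespace Hyp

open Polynomial Set
open scoped Nat

/-- The coefficient of `z ^ n` in the Gauss series `₂F₁(a, b; c; z)`. -/
noncomputable def coeff (a b c : ℂ) (n : ℕ) : ℂ :=
  (n ! : ℂ)⁻¹ * (ascPochhammer ℂ n).eval a * (ascPochhammer ℂ n).eval b *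
    ((ascPochhammer ℂ n).eval c)⁻¹

theorem coeff_zero (a b c : ℂ) : coeff a b c 0 = 1 := by simp [coeff]

theorem hyp_eq_tsum (a b c z : ℂ) :
    ordinaryHypergeometric a b c z = ∑' n, coeff a b c n * z ^ n := by
  rw [ordinaryHypergeometric_eq_tsum]; rfl

theorem hasSum_hyp (a b c : ℂ) {z : ℂ} (hz : ‖z‖ < 1) :
    HasSum (fun n => coeff a b c n * z ^ n) (ordinaryHypergeometric a b c z) := by
  rw [hyp_eq_tsum]
  exact (summable_norm_coeff a b c z hz).of_norm.hasSum

theorem hyp_symm (a b c z : ℂ) :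
    ordinaryHypergeometric a b c z = ordinaryHypergeometric b a c z := by
  rw [ordinaryHypergeometric, ordinaryHypergeometricSeries_symm]; rfl

theorem coeff_succ (a b : ℂ) {c : ℂ} (hc : ∀ k : ℕ, c ≠ -k) (n : ℕ) :
    (n + 1) * (c + n) * coeff a b c (n + 1) = (a + n) * (b + n) * coeff a b c n := by
  have h1 : c + n ≠ 0 := fun h => hc n (by linear_combination h)
  have h2 := poch_ne_zero hc n
  have h3 : (n : ℂ) + 1 ≠ 0 := by exact_mod_cast n.succ_ne_zero
  have h4 : (n ! : ℂ) ≠ 0 := by exact_mod_cast n.factorial_ne_zero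
  simp only [coeff, ascPochhammer_succ_eval, Nat.factorial_succ]
  push_cast
  field_simp

theorem coeff_succ_shift (a b : ℂ) {c : ℂ} (hc : ∀ k : ℕ, c ≠ -k) (n : ℕ) :
    (n + 1) * coeff a b c (n + 1) = a * b / c * coeff (a + 1) (b + 1) (c + 1) n := by
  have hc0 : c ≠ 0 := by simpa using hc 0
  have hc1 : ∀ k : ℕ, c + 1 ≠ -k := fun k h => hc (k + 1) (by push_cast; linear_combination h)
  have h2 := poch_ne_zero hc1 n
  have h3 : (n : ℂ) + 1 ≠ 0 := by exact_mod_cast n.succ_ne_zero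
  have h4 : (n ! : ℂ) ≠ 0 := by exact_mod_cast n.factorial_ne_zero
  simp only [coeff, poch_succ_left, Nat.factorial_succ]
  push_cast
  field_simp

theorem hasDerivAt_hyp (a b : ℂ) {c : ℂ} (hc : ∀ k : ℕ, c ≠ -k) {z : ℂ} (hz : ‖z‖ < 1) :
    HasDerivAt (ordinaryHypergeometric a b c : ℂ → ℂ)
      (a * b / c * ordinaryHypergeometric (a + 1) (b + 1) (c + 1) z) z := by
  obtain ⟨r, hr, hr1⟩ := exists_between hz
  have hr0 : 0 < r := (norm_nonneg z).trans_lt hr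
  have hrn : ‖(r : ℂ)‖ < 1 := by rwa [Complex.norm_real, Real.norm_eq_abs, abs_of_pos hr0]
  have e : (ordinaryHypergeometric a b c : ℂ → ℂ) = fun w => ∑' n, coeff a b c n * w ^ n :=
    funext (hyp_eq_tsum a b c)
  have hterm (n : ℕ) (w : ℂ) : coeff a b c (n + 1) * (((n + 1 : ℕ) : ℂ) * w ^ n)
      = a * b / c * (coeff (a + 1) (b + 1) (c + 1) n * w ^ n) := by
    have := coeff_succ_shift a b hc n
    push_cast
    linear_combination w ^ n * this
  -- After an index shift the termwise derivative is a multiple of the series with all parameters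
  -- raised by one, so its absolute convergence at `r` gives the majorant on the ball.
  have hu : Summable fun n : ℕ => ‖coeff a b c n * ((n : ℂ) * (r : ℂ) ^ (n - 1))‖ := by
    rw [← summable_nat_add_iff 1]
    simp only [Nat.add_sub_cancel, hterm, norm_mul (a * b / c)]
    exact (summable_norm_coeff (a + 1) (b + 1) (c + 1) r hrn).mul_left _
  have h := hasDerivAt_tsum_of_isPreconnected (𝕜 := ℂ)
    (g := fun n w => coeff a b c n * w ^ n)
    (g' := fun n w => coeff a b c n * ((n : ℂ) * w ^ (n - 1)))
    (t := Metric.ball (0 : ℂ) r) (y₀ := 0) (y := z) hu Metric.isOpen_ball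
    (convex_ball _ _).isPreconnected
    (fun n w _ => (hasDerivAt_pow n w).const_mul _)
    (fun n w hw => by
      have hw : ‖w‖ < r := by simpa using hw
      simp only [norm_mul, norm_pow, Complex.norm_real, Real.norm_eq_abs, abs_of_pos hr0]
      gcongr)
    (by simpa using hr0)
    (hasSum_hyp a b c (by simp)).summable (by simpa using hr)
  rw [e]
  convert! h using 1
  have hs : Summable fun n : ℕ => coeff a b c n * ((n : ℂ) * z ^ (n - 1)) := by
    rw [← summable_nat_add_iff 1]
    simp only [Nat.add_sub_cancel, hterm]
    exact ((hasSum_hyp _ _ _ hz).mul_left _).summable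
  rw [hs.tsum_eq_zero_add, hyp_eq_tsum, ← tsum_mul_left]
  simp only [Nat.cast_zero, zero_mul, mul_zero, zero_add, Nat.add_sub_cancel]
  exact tsum_congr fun n => (hterm n z).symm

/-- Gauss' hypergeometric differential equation. -/
theorem hyp_ode (a b : ℂ) {c : ℂ} (hc : ∀ k : ℕ, c ≠ -k) {z : ℂ} (hz : ‖z‖ < 1) :
    z * (1 - z) * (a * b / c * ((a + 1) * (b + 1) / (c + 1) *
        ordinaryHypergeometric (a + 1 + 1) (b + 1 + 1) (c + 1 + 1) z))
      + (c - (a + b + 1) * z) * (a * b / c * ordinaryHypergeometric (a + 1) (b + 1) (c + 1) z)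
      - a * b * ordinaryHypergeometric a b c z = 0 := by
  have hc1 : ∀ k : ℕ, c + 1 ≠ -k := fun k h => hc (k + 1) (by push_cast; linear_combination h)
  set C := coeff a b c with hC
  set F1 := a * b / c * ordinaryHypergeometric (a + 1) (b + 1) (c + 1) z with hF1
  set F2 := a * b / c * ((a + 1) * (b + 1) / (c + 1) *
        ordinaryHypergeometric (a + 1 + 1) (b + 1 + 1) (c + 1 + 1) z) with hF2
  have s0 : HasSum (fun n => C n * z ^ n) (ordinaryHypergeometric a b c z) := hasSum_hyp a b c hz
  have s1 : HasSum (fun n : ℕ => (n + 1) * C (n + 1) * z ^ n) F1 := by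
    convert! (hasSum_hyp (a + 1) (b + 1) (c + 1) hz).mul_left (a * b / c) using 2 with n
    rw [hC, coeff_succ_shift a b hc n]; ring
  have s2 : HasSum (fun n : ℕ => (n + 1) * (n + 2) * C (n + 2) * z ^ n) F2 := by
    convert! ((hasSum_hyp (a + 1 + 1) (b + 1 + 1) (c + 1 + 1) hz).mul_left
      ((a + 1) * (b + 1) / (c + 1))).mul_left (a * b / c) using 2 with n
    have e1 := coeff_succ_shift a b hc (n + 1)
    have e2 := coeff_succ_shift (a + 1) (b + 1) hc1 n
    push_cast at e1
    rw [hC]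
    linear_combination (n + 1) * z ^ n * e1 + a * b / c * z ^ n * e2
  have t1 : HasSum (fun n : ℕ => n * C n * z ^ n) (z * F1) := by
    rw [← hasSum_nat_add_iff' 1, Finset.sum_range_one, Nat.cast_zero]
    simp only [zero_mul, sub_zero]
    convert! s1.mul_left z using 2 with n
    push_cast; ring
  have t2 : HasSum (fun n : ℕ => n * (n + 1) * C (n + 1) * z ^ n) (z * F2) := by
    rw [← hasSum_nat_add_iff' 1, Finset.sum_range_one, Nat.cast_zero]
    simp only [zero_mul, sub_zero]
    convert! s2.mul_left z using 2 with n
    push_cast; ring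
  have t3 : HasSum (fun n : ℕ => n * (n - 1) * C n * z ^ n) (z * (z * F2)) := by
    rw [← hasSum_nat_add_iff' 1, Finset.sum_range_one, Nat.cast_zero]
    simp only [zero_mul, sub_zero]
    convert! t2.mul_left z using 2 with n
    push_cast; ring
  -- The `n`-th coefficient here is `(n+1)(c+n)C(n+1) - (a+n)(b+n)C(n)`, which vanishes by
  -- `coeff_succ`.
  have H := (((t2.sub t3).add (s1.mul_left c)).sub (t1.mul_left (a + b + 1))).sub
    (s0.mul_left (a * b))
  have H0 : HasSum (fun _ : ℕ => (0 : ℂ)) (z * F2 - z * (z * F2) + c * F1 -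
      (a + b + 1) * (z * F1) - a * b * ordinaryHypergeometric a b c z) := by
    convert! H using 2 with n
    have := coeff_succ a b hc n
    rw [← hC] at this
    linear_combination -z ^ n * this
  linear_combination H0.unique hasSum_zero

theorem analyticAt_pfaff (a b c : ℂ) {x : ℝ} (hx : x < 1 / 2) :
    AnalyticAt ℝ (fun x : ℝ => (1 - (x : ℂ)) ^ (-a) *
      ordinaryHypergeometric a (c - b) c ((x : ℂ) / (x - 1))) x := by
  have hof : AnalyticAt ℝ (fun x : ℝ => (x : ℂ)) x := Complex.ofRealCLM.analyticAt x
  have h1 : (x : ℂ) - 1 ≠ 0 := by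
    intro h
    have h' : x - 1 = 0 := by exact_mod_cast h
    linarith
  have h2 : ‖(x : ℂ) / (x - 1)‖ < 1 := by
    have : (x : ℂ) / (x - 1) = ((x / (x - 1) : ℝ) : ℂ) := by push_cast; rfl
    rw [this, Complex.norm_real, Real.norm_eq_abs, abs_div, div_lt_one (by
      rw [abs_pos]; intro h; linarith), abs_of_neg (show x - 1 < 0 by linarith), abs_lt]
    constructor <;> linarith
  have g := (analyticAt_hyp a (c - b) c _ h2).restrictScalars (𝕜 := ℝ)
  have g2 : AnalyticAt ℝ (fun x : ℝ => (x : ℂ) / (x - 1)) x :=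
    hof.div (hof.sub analyticAt_const) h1
  have g3 : AnalyticAt ℂ (fun z : ℂ => (1 - z) ^ (-a)) (x : ℂ) := by
    apply AnalyticAt.cpow (analyticAt_const.sub analyticAt_id) analyticAt_const
    left
    simp; linarith
  exact ((g3.restrictScalars (𝕜 := ℝ)).fun_comp hof).mul
    (AnalyticAt.fun_comp (f := fun x : ℝ => (x : ℂ) / (x - 1)) g g2)

/-- Pfaff's transformation. -/
theorem gauss2F1_pfaff (a b : ℂ) {c : ℂ} (hc : ∀ k : ℕ, c ≠ -k) {x : ℝ} (hx : x < 1 / 2) :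
    gauss2F1 a b c x = (1 - (x : ℂ)) ^ (-a) *
      ordinaryHypergeometric a (c - b) c ((x : ℂ) / (x - 1)) := by
  refine AnalyticOnNhd.eqOn_of_preconnected_of_eventuallyEq (𝕜 := ℝ)
    ((gauss2F1_analytic a b hc).mono (Iio_subset_Iio (by norm_num : (1 / 2 : ℝ) ≤ 1)))
    (fun x hx => analyticAt_pfaff a b c hx) isPreconnected_Iio (z₀ := 0) (by norm_num) ?_ hx
  filter_upwards [Ioo_mem_nhds (show (-(1 / 3) : ℝ) < 0 by norm_num)
    (show (0 : ℝ) < 1 / 3 by norm_num)] with y hy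
  have hy' : |y| < 1 / 3 := abs_lt.2 hy
  rw [gauss2F1_eq_series a b hc (hy'.trans (by norm_num)), pfaff_near_zero a b hc hy']

theorem gauss2F1_symm (a b : ℂ) {c : ℂ} (hc : ∀ k : ℕ, c ≠ -k) {x : ℝ} (hx : x < 1) :
    gauss2F1 a b c x = gauss2F1 b a c x :=
  eq_of_continuation (F := fun x => ordinaryHypergeometric a b c (x : ℂ))
    (gauss2F1_analytic a b hc) (gauss2F1_analytic b a hc)
    (fun _ h => gauss2F1_eq_series a b hc h)
    (fun _ h => by rw [gauss2F1_eq_series b a hc h, hyp_symm]) hx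

end Hyp

/-! ### The Jacobi function as an exponential times a hypergeometric factor. -/

theorem ofReal_add_one_ne_neg_nat {α : ℝ} (hα : -1 < α) (k : ℕ) : (α : ℂ) + 1 ≠ -k := by
  intro h
  have h' : α + 1 = -k := by exact_mod_cast h
  have : (0 : ℝ) ≤ k := k.cast_nonneg
  linarith

theorem Real.one_sub_tanh_sq (t : ℝ) : 1 - Real.tanh t ^ 2 = (Real.cosh t ^ 2)⁻¹ := by
  have h := (Real.cosh_pos t).ne'
  rw [Real.tanh_eq_sinh_div_cosh]
  field_simp
  linarith [Real.cosh_sq t]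

/-- At `μ = iρ + iz` the upper parameters are `ρ + z/2` and `-z/2`. They are swapped before Pfaff's
transformation so that the prefactor is `(cosh² t)^(z/2)` and `c - b = -β - z/2`; the argument
`x/(x-1)` becomes `tanh² t`. -/
theorem jacobiFunction_eq_exp_mul_hyp {α β : ℝ} (hα : -1 < α) (z : ℂ) (t : ℝ) :
    jacobiFunction α β (Complex.I * jacobiRho α β + Complex.I * z) t
      = Complex.exp (z * Real.log (Real.cosh t)) *
        ordinaryHypergeometric (-z / 2) (-β - z / 2) (α + 1 : ℂ)
          ((Real.tanh t ^ 2 : ℝ) : ℂ) := by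
  have hc := ofReal_add_one_ne_neg_nat hα
  have hx : -(Real.sinh t) ^ 2 < (1 / 2 : ℝ) := by nlinarith [sq_nonneg (Real.sinh t)]
  have hch := Real.cosh_pos t
  have hsq := Real.cosh_sq t
  rw [jacobiFunction, Hyp.gauss2F1_symm _ _ hc (by linarith), Hyp.gauss2F1_pfaff _ _ hc hx]
  have hI := Complex.I_mul_I
  congr 1
  · rw [show (1 : ℂ) - ((-(Real.sinh t) ^ 2 : ℝ) : ℂ) = ((Real.cosh t ^ 2 : ℝ) : ℂ) by
      rw [hsq]; push_cast; ring,
      Complex.cpow_def_of_ne_zero (by exact_mod_cast (pow_pos hch 2).ne'),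
      ← Complex.ofReal_log (by positivity), Real.log_pow, jacobiRho]
    congr 1
    push_cast
    linear_combination (-(Real.log (Real.cosh t) : ℂ)) * ((α : ℂ) + β + 1 + z) * hI
  · congr 1
    · rw [jacobiRho]; push_cast
      linear_combination ((α : ℂ) + β + 1 + z) / 2 * hI
    · rw [jacobiRho]; push_cast
      linear_combination ((α : ℂ) + β + 1 + z) / 2 * hI
    · rw [← Complex.ofReal_one, ← Complex.ofReal_sub, ← Complex.ofReal_div]
      congr 1
      rw [Real.tanh_eq_sinh_div_cosh, div_pow, hsq]
      have : Real.sinh t ^ 2 + 1 ≠ 0 := by positivity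
      have h2 : -Real.sinh t ^ 2 - 1 ≠ 0 := by intro h; apply this; linarith
      field_simp
      ring

/-! ### Uniform first order expansion at `z = 0`. -/

theorem summable_of_eventually_le_sub_succ {u v : ℕ → ℝ} (N : ℕ) (hu : ∀ n, 0 ≤ u n)
    (hv : ∀ n, 0 ≤ v n) (h : ∀ n, N ≤ n → u n ≤ v n - v (n + 1)) : Summable u := by
  rw [← summable_nat_add_iff N]
  refine summable_of_sum_range_le (c := v N) (fun n => hu _) fun m => ?_
  calc ∑ i ∈ Finset.range m, u (i + N)
      ≤ ∑ i ∈ Finset.range m, (v (i + N) - v (i + 1 + N)) := by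
        refine Finset.sum_le_sum fun i _ => ?_
        have := h (i + N) (by omega)
        rwa [show i + N + 1 = i + 1 + N by ring] at this
    _ = v N - v (m + N) := by
        rw [Finset.sum_range_sub' (fun i => v (i + N))]; simp
    _ ≤ v N := by linarith [hv (m + N)]

/-- The Schwarz lemma applied twice: to `f`, bounding `dslope f 0` by `2M/r`, and then to `dslope f
0` itself, whose value at `0` is `f'(0)`. -/
theorem Complex.norm_sub_sub_deriv_mul_le_of_forall_ball_norm_le {f : ℂ → ℂ} {r M : ℝ} (hr : 0 < r)
    (hf : DifferentiableOn ℂ f (Metric.ball 0 r)) (hM : ∀ z ∈ Metric.ball (0 : ℂ) r, ‖f z‖ ≤ M) :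
    ‖deriv f 0‖ ≤ 2 * M / r ∧
      ∀ z ∈ Metric.ball (0 : ℂ) r, ‖f z - f 0 - deriv f 0 * z‖ ≤ 4 * M / r ^ 2 * ‖z‖ ^ 2 := by
  have h0 : (0 : ℂ) ∈ Metric.ball (0 : ℂ) r := Metric.mem_ball_self hr
  have hg : ∀ z ∈ Metric.ball (0 : ℂ) r, ‖dslope f 0 z‖ ≤ 2 * M / r := by
    intro z hz
    refine Complex.norm_dslope_le_div_of_mapsTo_ball hf (fun w hw => ?_) hz
    rw [Metric.mem_closedBall, dist_eq_norm]
    linarith [norm_sub_le (f w) (f 0), hM w hw, hM 0 h0]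
  refine ⟨by simpa [dslope_same] using hg 0 h0, fun z hz => ?_⟩
  have hd : DifferentiableOn ℂ (dslope f 0) (Metric.ball 0 r) :=
    (Complex.differentiableOn_dslope (Metric.ball_mem_nhds _ hr)).2 hf
  have h1 := Complex.dist_le_div_mul_dist_of_mapsTo_ball (R₂ := 2 * (2 * M / r)) hd
    (fun w hw => by
      rw [Metric.mem_closedBall, dist_eq_norm]
      linarith [norm_sub_le (dslope f 0 w) (dslope f 0 0), hg w hw, hg 0 h0]) hz
  rw [dist_eq_norm, dist_eq_norm, dslope_same, sub_zero] at h1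
  have h2 : f z - f 0 - deriv f 0 * z = z * (dslope f 0 z - deriv f 0) := by
    have := sub_smul_dslope f 0 z
    rw [sub_zero, smul_eq_mul] at this
    rw [mul_sub, this]; ring
  rw [h2, norm_mul]
  calc ‖z‖ * ‖dslope f 0 z - deriv f 0‖ ≤ ‖z‖ * (2 * (2 * M / r) / r * ‖z‖) := by gcongr
    _ = _ := by field_simp; ring

namespace Hyp

open Polynomial
open scoped Nat

/-- The real coefficients of the Gauss series. -/
noncomputable def coeffReal (a b c : ℝ) (n : ℕ) : ℝ :=
  (n ! : ℝ)⁻¹ * (ascPochhammer ℝ n).eval a * (ascPochhammer ℝ n).eval b *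
    ((ascPochhammer ℝ n).eval c)⁻¹

theorem ofReal_poch (a : ℝ) (n : ℕ) :
    (((ascPochhammer ℝ n).eval a : ℝ) : ℂ) = (ascPochhammer ℂ n).eval (a : ℂ) := by
  induction n with
  | zero => simp
  | succ n ih => simp [ascPochhammer_succ_eval, ih]

theorem ofReal_coeffReal (a b c : ℝ) (n : ℕ) :
    (coeffReal a b c n : ℂ) = coeff (a : ℂ) (b : ℂ) (c : ℂ) n := by
  simp only [coeffReal, coeff]; push_cast [ofReal_poch]; rfl

theorem coeffReal_nonneg {a b c : ℝ} (ha : 0 ≤ a) (hb : 0 ≤ b) (hc : 0 < c) (n : ℕ) :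
    0 ≤ coeffReal a b c n := by
  have h (x : ℝ) (hx : 0 ≤ x) : 0 ≤ (ascPochhammer ℝ n).eval x := by
    induction n with
    | zero => simp
    | succ n ih => rw [ascPochhammer_succ_eval]; positivity
  have := h a ha
  have := h b hb
  have := h c hc.le
  unfold coeffReal
  positivity

theorem norm_coeff_le {a b : ℂ} {A B c : ℝ} (ha : ‖a‖ ≤ A) (hb : ‖b‖ ≤ B) (hc : 0 < c) (n : ℕ) :
    ‖coeff a b c n‖ ≤ coeffReal A B c n := by
  have h1 := norm_poch_le a A ha n
  have h2 := norm_poch_le b B hb n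
  have h3 := ascPochhammer_pos n c hc
  rw [coeff, coeffReal, ← ofReal_poch, norm_mul, norm_mul, norm_mul, norm_inv, norm_inv,
    Complex.norm_natCast, Complex.norm_real, Real.norm_of_nonneg h3.le]
  have := (norm_nonneg _).trans h1
  gcongr

/-- Raabe's test in telescoping form: with `δ = c - a - b`, the sequence `(2/δ) n A_n` eventually
drops by at least `A_n` at each step. This is convergence of the Gauss series at `y = 1`. -/
theorem summable_coeffReal {a b c : ℝ} (ha : 0 ≤ a) (hb : 0 ≤ b) (h : a + b < c) :
    Summable (coeffReal a b c) := by
  have hc : 0 < c := by linarith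
  set δ := c - a - b with hδ
  have hδ0 : 0 < δ := by linarith
  have h0 := coeffReal_nonneg ha hb hc
  obtain ⟨N, hN⟩ := exists_nat_ge (2 / δ * (a * b) + c)
  refine summable_of_eventually_le_sub_succ (v := fun n => 2 / δ * (n * coeffReal a b c n)) N h0
    (fun n => by have := h0 n; positivity) fun n hn => ?_
  have hcn : (0 : ℝ) < c + n := by positivity
  have hr : ((n : ℝ) + 1) * coeffReal a b c (n + 1)
      = (a + n) * (b + n) / (c + n) * coeffReal a b c n := by
    have hp := (ascPochhammer_pos n c hc).ne'
    have : (n ! : ℝ) ≠ 0 := by exact_mod_cast n.factorial_ne_zero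
    simp only [coeffReal, ascPochhammer_succ_eval, Nat.factorial_succ]
    push_cast
    field_simp
  push_cast
  rw [hr]
  -- The difference `n - (a+n)(b+n)/(c+n)` equals `(δn - ab)/(c+n)`, so the inequality amounts to `n
  -- ≥ 2ab/δ + c`, which is how `N` was chosen.
  have hle : 1 ≤ 2 / δ * (n - (a + n) * (b + n) / (c + n)) := by
    have hn' : 2 / δ * (a * b) + c ≤ n := hN.trans (by exact_mod_cast hn)
    have e : 2 / δ * (n - (a + n) * (b + n) / (c + n)) = (2 * n - 2 / δ * (a * b)) / (c + n) := by
      have : (n : ℝ) - (a + n) * (b + n) / (c + n) = (δ * n - a * b) / (c + n) := by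
        rw [hδ]; field_simp; ring
      rw [this]
      field_simp
    rw [e, le_div_iff₀ hcn]
    linarith
  nlinarith [h0 n]

/-- The factor `₂F₁(-z/2, -β - z/2; α + 1; y)` of the Jacobi function `φ_{iρ + iz}`. -/
noncomputable def jacobiFactor (α β : ℝ) (y : ℝ) (z : ℂ) : ℂ :=
  ordinaryHypergeometric (-z / 2) (-β - z / 2) (α + 1 : ℂ) (y : ℂ)

theorem jacobiFactor_zero (α β y : ℝ) : jacobiFactor α β y 0 = 1 := by
  rw [jacobiFactor, hyp_eq_tsum, tsum_eq_single 0]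
  · simp [coeff_zero]
  · intro n hn
    have : (ascPochhammer ℂ n).eval 0 = 0 := by simp [hn]
    simp [coeff, this]

theorem norm_ofReal_lt_one {y : ℝ} (hy0 : 0 ≤ y) (hy : y < 1) : ‖(y : ℂ)‖ < 1 := by
  rwa [Complex.norm_real, Real.norm_of_nonneg hy0]

/-- Makes the derivative at `z = 0` real, so that `exp(iλD)` has modulus one. -/
theorem im_jacobiFactor_ofReal (α β : ℝ) {y : ℝ} (hy0 : 0 ≤ y) (hy : y < 1) (s : ℝ) :
    (jacobiFactor α β y s).im = 0 := by
  have h := Complex.hasSum_im (hasSum_hyp (-(s : ℂ) / 2) (-β - s / 2) (α + 1) (norm_ofReal_lt_one hy0 hy))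
  refine h.unique ?_
  convert! (hasSum_zero : HasSum (fun _ : ℕ => (0 : ℝ)) 0) using 2 with n
  have e := ofReal_coeffReal (-s / 2) (-β - s / 2) (α + 1) n
  push_cast at e
  rw [← e, ← Complex.ofReal_pow, ← Complex.ofReal_mul, Complex.ofReal_im]

theorem differentiable_poch (n : ℕ) {g : ℂ → ℂ} (hg : Differentiable ℂ g) :
    Differentiable ℂ fun z => (ascPochhammer ℂ n).eval (g z) :=
  (ascPochhammer ℂ n).differentiable.comp hg

/-- Near `z = 0` the factor is holomorphic in `z` and bounded uniformly in `y`. -/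
theorem exists_forall_norm_jacobiFactor_le {α β : ℝ} (hβα : β ≤ α) (hβ : -(1 / 2 : ℝ) ≤ β)
    (hα : -(1 / 2 : ℝ) < α) :
    ∃ r M : ℝ, 0 < r ∧ 0 < M ∧ ∀ y : ℝ, 0 ≤ y → y < 1 →
      DifferentiableOn ℂ (jacobiFactor α β y) (Metric.ball 0 r) ∧
      ∀ z ∈ Metric.ball (0 : ℂ) r, ‖jacobiFactor α β y z‖ ≤ M := by
  have hb : |β| < α + 1 := abs_lt.2 ⟨by linarith, by linarith⟩
  -- For `‖z‖ < r` the upper parameters have norms at most `r/2` and `|β| + r/2`. Their sum `|β| +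
  -- r` is below `α + 1`, so the majorant converges at `y = 1`.
  set r := (α + 1 - |β|) / 2 with hr
  have hr0 : 0 < r := by linarith
  have hs : Summable (coeffReal (r / 2) (|β| + r / 2) (α + 1)) :=
    summable_coeffReal (by positivity) (by positivity) (by linarith)
  have hbd : ∀ y : ℝ, 0 ≤ y → y < 1 → ∀ (n : ℕ), ∀ z ∈ Metric.ball (0 : ℂ) r,
      ‖coeff (-z / 2) (-β - z / 2) (α + 1) n * (y : ℂ) ^ n‖
        ≤ coeffReal (r / 2) (|β| + r / 2) (α + 1) n := by
    intro y hy0 hy n z hz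
    have hz : ‖z‖ < r := by simpa using hz
    have hz2 : ‖z / 2‖ ≤ r / 2 := by
      rw [norm_div, Complex.norm_ofNat]; linarith
    have h1 : ‖-z / 2‖ ≤ r / 2 := by rwa [neg_div, norm_neg]
    have h2 : ‖-(β : ℂ) - z / 2‖ ≤ |β| + r / 2 := by
      refine (norm_sub_le _ _).trans ?_
      rw [norm_neg, Complex.norm_real, Real.norm_eq_abs]; linarith
    have h3 := norm_coeff_le (c := α + 1) h1 h2 (by linarith) n
    push_cast at h3
    have h4 : ‖(y : ℂ) ^ n‖ ≤ 1 := by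
      rw [norm_pow]; exact pow_le_one₀ (norm_nonneg _) (norm_ofReal_lt_one hy0 hy).le
    rw [norm_mul]
    exact (mul_le_of_le_one_right (norm_nonneg _) h4).trans h3
  refine ⟨r, ∑' n, coeffReal (r / 2) (|β| + r / 2) (α + 1) n, hr0, ?_, fun y hy0 hy => ⟨?_, ?_⟩⟩
  · refine hs.tsum_pos (fun n => coeffReal_nonneg (by positivity) (by positivity) (by linarith) n) 0 ?_
    simp [coeffReal]
  · have e : jacobiFactor α β y = fun z => ∑' n, coeff (-z / 2) (-β - z / 2) (α + 1) n * (y : ℂ) ^ n :=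
      funext fun z => hyp_eq_tsum _ _ _ _
    rw [e]
    refine Complex.differentiableOn_tsum_of_summable_norm hs (fun n => ?_) Metric.isOpen_ball
      (hbd y hy0 hy)
    have d1 : Differentiable ℂ fun z : ℂ => -z / 2 := by fun_prop
    have d2 : Differentiable ℂ fun z : ℂ => -(β : ℂ) - z / 2 := by fun_prop
    have d3 := differentiable_poch n d1
    have d4 := differentiable_poch n d2
    unfold coeff
    exact ((((d3.const_mul _).mul d4).mul_const _).mul_const _).differentiableOn
  · intro z hz
    rw [jacobiFactor, hyp_eq_tsum]
    exact tsum_of_norm_bounded hs.hasSum fun n => hbd y hy0 hy n z hz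

/-- First order expansion of the factor at `z = 0`, uniform in `y`. -/
theorem exists_forall_norm_jacobiFactor_sub_le {α β : ℝ} (hβα : β ≤ α) (hβ : -(1 / 2 : ℝ) ≤ β)
    (hα : -(1 / 2 : ℝ) < α) :
    ∃ r K : ℝ, 0 < r ∧ 0 < K ∧ ∀ y : ℝ, 0 ≤ y → y < 1 →
      ∃ D : ℝ, |D| ≤ K ∧ HasDerivAt (jacobiFactor α β y) D 0 ∧
      ∀ z ∈ Metric.ball (0 : ℂ) r, ‖jacobiFactor α β y z - 1 - D * z‖ ≤ K * ‖z‖ ^ 2 := by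
  obtain ⟨r, M, hr, hM, h⟩ := exists_forall_norm_jacobiFactor_le hβα hβ hα
  refine ⟨r, max (2 * M / r) (4 * M / r ^ 2), hr, lt_max_of_lt_left (by positivity),
    fun y hy0 hy => ?_⟩
  obtain ⟨hd, hb⟩ := h y hy0 hy
  obtain ⟨h1, h2⟩ := Complex.norm_sub_sub_deriv_mul_le_of_forall_ball_norm_le hr hd hb
  have hD : HasDerivAt (jacobiFactor α β y) (deriv (jacobiFactor α β y) 0) 0 :=
    (hd.differentiableAt (Metric.ball_mem_nhds _ hr)).hasDerivAt
  have him : (deriv (jacobiFactor α β y) 0).im = 0 := by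
    have hD' : HasDerivAt (jacobiFactor α β y) (deriv (jacobiFactor α β y) 0) ((0 : ℝ) : ℂ) := by
      simpa using hD
    have h3 : HasDerivAt (fun s : ℝ => (jacobiFactor α β y s).im)
        (deriv (jacobiFactor α β y) 0).im 0 :=
      Complex.imCLM.hasFDerivAt.comp_hasDerivAt _ hD'.comp_ofReal
    simp only [im_jacobiFactor_ofReal α β hy0 hy] at h3
    exact h3.unique (hasDerivAt_const _ _)
  have he : ((deriv (jacobiFactor α β y) 0).re : ℂ) = deriv (jacobiFactor α β y) 0 :=
    Complex.ext rfl (by rw [Complex.ofReal_im, him])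
  refine ⟨(deriv (jacobiFactor α β y) 0).re, ?_, by rwa [he], fun z hz => ?_⟩
  · exact ((Complex.abs_re_le_norm _).trans h1).trans (le_max_left _ _)
  · have := h2 z hz
    rw [jacobiFactor_zero] at this
    rw [he]
    refine this.trans ?_
    gcongr
    exact le_max_right _ _

end Hyp

/-! ### The decreasing energy and the Jacobi differential equation. -/

open Set in
/-- For a solution of `φ'' + p φ' + (lam² - 2iρ lam) φ = 0` with decreasing `p ≥ 2ρ ≥ 0`, the energy
`‖φ' + ρ φ‖² + (lam² - ρ² + ρ p) ‖φ‖²` is decreasing. -/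
theorem antitoneOn_energy {φ φ₁ : ℝ → ℂ} {p p' : ℝ → ℝ} {ρ lam : ℝ} (hρ : 0 ≤ ρ)
    (hφ : ∀ t, 0 < t → HasDerivAt φ (φ₁ t) t)
    (hφ₁ : ∀ t, 0 < t → HasDerivAt φ₁
      (-p t * φ₁ t - (lam ^ 2 - 2 * Complex.I * ρ * lam) * φ t) t)
    (hp : ∀ t, 0 < t → HasDerivAt p (p' t) t) (hp2 : ∀ t, 0 < t → 2 * ρ ≤ p t)
    (hp' : ∀ t, 0 < t → p' t ≤ 0) :
    AntitoneOn (fun t => ‖φ₁ t + ρ * φ t‖ ^ 2 + (lam ^ 2 - ρ ^ 2 + ρ * p t) * ‖φ t‖ ^ 2)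
      (Ioi 0) := by
  -- The weight `lam² - ρ² + ρp` cancels the terms in `Re(φ' φ̄)`; the nonreal coefficient `2iρ lam`
  -- contributes exactly the cross term of `‖φ' - i lam φ‖²`.
  have key : ∀ t, 0 < t → HasDerivAt
      (fun t => ‖φ₁ t + ρ * φ t‖ ^ 2 + (lam ^ 2 - ρ ^ 2 + ρ * p t) * ‖φ t‖ ^ 2)
      (-2 * (p t - 2 * ρ) * ‖φ₁ t‖ ^ 2 - 2 * ρ * ‖φ₁ t - Complex.I * lam * φ t‖ ^ 2
        + ρ * p' t * ‖φ t‖ ^ 2) t := by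
    intro t ht
    have h1 := ((hφ₁ t ht).add ((hφ t ht).const_mul (ρ : ℂ))).norm_sq
    have h2 := (hφ t ht).norm_sq
    have h3 := ((hp t ht).const_mul ρ).const_add (lam ^ 2 - ρ ^ 2)
    convert! h1.add (h3.mul h2) using 1
    simp only [Complex.inner, ← Complex.normSq_eq_norm_sq, Complex.normSq_apply]
    simp [pow_two]
    ring
  refine antitoneOn_of_deriv_nonpos (convex_Ioi 0)
    (fun t ht => (key t ht).continuousAt.continuousWithinAt) ?_ ?_ <;> rw [interior_Ioi]
  · exact fun t ht => (key t ht).differentiableAt.differentiableWithinAt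
  · intro t ht
    rw [(key t ht).deriv]
    have h1 := mul_nonneg (sub_nonneg.2 (hp2 t ht)) (sq_nonneg ‖φ₁ t‖)
    have h2 := mul_nonneg hρ (sq_nonneg ‖φ₁ t - Complex.I * lam * φ t‖)
    have h3 := mul_nonneg (mul_nonneg hρ (neg_nonneg.2 (hp' t ht))) (sq_nonneg ‖φ t‖)
    nlinarith

theorem Real.hasDerivAt_tanh_one_sub_sq (t : ℝ) :
    HasDerivAt Real.tanh (1 - Real.tanh t ^ 2) t := by
  have h := (Real.hasDerivAt_sinh t).div (Real.hasDerivAt_cosh t) (Real.cosh_pos t).ne'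
  have e : Real.tanh = fun t => Real.sinh t / Real.cosh t :=
    funext Real.tanh_eq_sinh_div_cosh
  rw [Real.one_sub_tanh_sq, e]
  convert! h using 1
  rw [Real.cosh_sq]
  have : Real.sinh t ^ 2 + 1 ≠ 0 := by positivity
  field_simp
  linarith [Real.cosh_sq t]

theorem Real.hasDerivAt_log_cosh (t : ℝ) :
    HasDerivAt (fun t => Real.log (Real.cosh t)) (Real.tanh t) t := by
  rw [Real.tanh_eq_sinh_div_cosh]
  exact (Real.hasDerivAt_cosh t).log (Real.cosh_pos t).ne'

theorem Real.tanh_pos_of_pos {t : ℝ} (ht : 0 < t) : 0 < Real.tanh t := by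
  rw [Real.tanh_eq_sinh_div_cosh]
  exact div_pos (Real.sinh_pos_iff.2 ht) (Real.cosh_pos t)

namespace Hyp

/-- The derivative of `jacobiFactor α β y z` in `y`. -/
noncomputable def jacobiFactorDeriv (α β : ℝ) (y : ℝ) (z : ℂ) : ℂ :=
  (-z / 2) * (-β - z / 2) / (α + 1) *
    ordinaryHypergeometric (-z / 2 + 1) (-β - z / 2 + 1) (α + 1 + 1 : ℂ) (y : ℂ)

theorem hasDerivAt_jacobiFactor {α : ℝ} (β : ℝ) (hα : -1 < α) (z : ℂ) {y : ℝ} (hy0 : 0 ≤ y)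
    (hy : y < 1) :
    HasDerivAt (fun y : ℝ => jacobiFactor α β y z) (jacobiFactorDeriv α β y z) y :=
  (hasDerivAt_hyp _ _ (ofReal_add_one_ne_neg_nat hα) (norm_ofReal_lt_one hy0 hy)).comp_ofReal

theorem exists_hasDerivAt_jacobiFactorDeriv {α : ℝ} (β : ℝ) (hα : -1 < α) (z : ℂ) {y : ℝ}
    (hy0 : 0 ≤ y) (hy : y < 1) :
    ∃ F₂ : ℂ, HasDerivAt (fun y : ℝ => jacobiFactorDeriv α β y z) F₂ y ∧
      y * (1 - y) * F₂ + (α + 1 - (-z / 2 + (-β - z / 2) + 1) * y) * jacobiFactorDeriv α β y z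
        - (-z / 2) * (-β - z / 2) * jacobiFactor α β y z = 0 := by
  have hc := ofReal_add_one_ne_neg_nat hα
  have hc1 : ∀ k : ℕ, (α : ℂ) + 1 + 1 ≠ -k :=
    fun k h => hc (k + 1) (by push_cast; linear_combination h)
  have hn := norm_ofReal_lt_one hy0 hy
  exact ⟨_, ((hasDerivAt_hyp (-z / 2 + 1) (-β - z / 2 + 1) hc1 hn).comp_ofReal).const_mul _,
    hyp_ode _ _ hc hn⟩

/-- The function `φ_{iρ - lam}`, see `jacobiFunction_eq_exp_mul_hyp`. -/
noncomputable def jacobiPhi (α β lam t : ℝ) : ℂ :=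
  Complex.exp (Complex.I * lam * Real.log (Real.cosh t)) *
    jacobiFactor α β (Real.tanh t ^ 2) (Complex.I * lam)

/-- The derivative of `jacobiPhi` in `t`. -/
noncomputable def jacobiPhiDeriv (α β lam t : ℝ) : ℂ :=
  Complex.exp (Complex.I * lam * Real.log (Real.cosh t)) *
    (Complex.I * lam * Real.tanh t * jacobiFactor α β (Real.tanh t ^ 2) (Complex.I * lam)
      + 2 * Real.tanh t * (1 - Real.tanh t ^ 2) *
        jacobiFactorDeriv α β (Real.tanh t ^ 2) (Complex.I * lam))

theorem hasDerivAt_exp_log_cosh (lam t : ℝ) :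
    HasDerivAt (fun t : ℝ => Complex.exp (Complex.I * lam * Real.log (Real.cosh t)))
      (Complex.exp (Complex.I * lam * Real.log (Real.cosh t)) *
        (Complex.I * lam * Real.tanh t)) t :=
  ((Real.hasDerivAt_log_cosh t).ofReal_comp.const_mul (Complex.I * lam)).cexp

theorem hasDerivAt_tanh_sq (t : ℝ) :
    HasDerivAt (fun t => Real.tanh t ^ 2) (2 * Real.tanh t * (1 - Real.tanh t ^ 2)) t := by
  convert! (Real.hasDerivAt_tanh_one_sub_sq t).pow 2 using 1
  simp

theorem hasDerivAt_jacobiPhi {α : ℝ} (β : ℝ) (hα : -1 < α) (lam t : ℝ) :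
    HasDerivAt (jacobiPhi α β lam) (jacobiPhiDeriv α β lam t) t := by
  have h1 := (hasDerivAt_jacobiFactor β hα (Complex.I * lam) (sq_nonneg (Real.tanh t))
    (Real.tanh_sq_lt_one t)).scomp t (hasDerivAt_tanh_sq t)
  convert! (hasDerivAt_exp_log_cosh lam t).mul h1 using 1
  simp only [jacobiPhiDeriv, Function.comp, Complex.real_smul]
  push_cast
  ring

/-- The logarithmic derivative of the weight `sinh^(2α+1) cosh^(2β+1)`. -/
noncomputable def jacobiDrift (α β t : ℝ) : ℝ :=
  (2 * α + 1) / Real.tanh t + (2 * β + 1) * Real.tanh t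

theorem hasDerivAt_jacobiPhiDeriv {α : ℝ} (β : ℝ) (hα : -1 < α) (lam : ℝ) {t : ℝ} (ht : 0 < t) :
    HasDerivAt (jacobiPhiDeriv α β lam) (-(jacobiDrift α β t : ℝ) * jacobiPhiDeriv α β lam t -
      (lam ^ 2 - 2 * Complex.I * jacobiRho α β * lam) * jacobiPhi α β lam t) t := by
  have hy0 := sq_nonneg (Real.tanh t)
  have hy1 := Real.tanh_sq_lt_one t
  obtain ⟨F₂, h2, hode⟩ := exists_hasDerivAt_jacobiFactorDeriv β hα (Complex.I * lam) hy0 hy1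
  have hF := (hasDerivAt_jacobiFactor β hα (Complex.I * lam) hy0 hy1).scomp t (hasDerivAt_tanh_sq t)
  have hF1 := h2.scomp t (hasDerivAt_tanh_sq t)
  have hτ := (Real.hasDerivAt_tanh_one_sub_sq t).ofReal_comp
  have hd := (hτ.const_mul 2).mul ((hτ.pow 2).const_sub 1)
  have hτ0 : (Real.tanh t : ℂ) ≠ 0 := by exact_mod_cast (Real.tanh_pos_of_pos ht).ne'
  convert! (hasDerivAt_exp_log_cosh lam t).mul
    (((hτ.const_mul (Complex.I * lam)).mul hF).add (hd.mul hF1)) using 1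
  simp only [jacobiPhiDeriv, jacobiPhi, jacobiDrift, jacobiRho, Function.comp, Complex.real_smul,
    Pi.add_apply, Pi.mul_apply, Pi.pow_apply, Complex.ofReal_add, Complex.ofReal_sub,
    Complex.ofReal_mul, Complex.ofReal_div, Complex.ofReal_pow, Complex.ofReal_one,
    Complex.ofReal_ofNat] at hode ⊢
  generalize Complex.exp (Complex.I * lam * (Real.log (Real.cosh t) : ℂ)) = e
  generalize jacobiFactor α β (Real.tanh t ^ 2) (Complex.I * lam) = F at *
  generalize jacobiFactorDeriv α β (Real.tanh t ^ 2) (Complex.I * lam) = F₁ at *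
  generalize (Real.tanh t : ℂ) = τ at *
  field_simp
  -- With `y = τ²`, `(dy/dt)² = 4y(1-y)²`, so `4(1-y)` times the hypergeometric equation is the
  -- Jacobi equation.
  linear_combination (-4 * e * (1 - τ ^ 2)) * hode - e * lam ^ 2 * F * Complex.I_sq

theorem hasDerivAt_jacobiDrift (α β : ℝ) {t : ℝ} (ht : 0 < t) :
    HasDerivAt (jacobiDrift α β)
      (((2 * β + 1) - (2 * α + 1) / Real.tanh t ^ 2) * (1 - Real.tanh t ^ 2)) t := by
  have hτ := Real.hasDerivAt_tanh_one_sub_sq t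
  have h0 := (Real.tanh_pos_of_pos ht).ne'
  convert! ((hasDerivAt_const t (2 * α + 1)).div hτ h0).add (hτ.const_mul (2 * β + 1)) using 1
  field_simp
  ring

/-- The difference factors as `(1-τ)((2α+1) - (2β+1)τ)/τ` with `τ = tanh t ∈ (0,1)`, and `β ≤ α`
makes the second factor nonnegative. -/
theorem two_mul_jacobiRho_le_jacobiDrift {α β : ℝ} (hβα : β ≤ α) (hα : -(1 / 2 : ℝ) < α)
    {t : ℝ} (ht : 0 < t) : 2 * jacobiRho α β ≤ jacobiDrift α β t := by
  have h0 := Real.tanh_pos_of_pos ht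
  have h1 := (Real.tanh_lt_one t).le
  have e : jacobiDrift α β t - 2 * jacobiRho α β
      = (1 - Real.tanh t) * ((2 * α + 1) - (2 * β + 1) * Real.tanh t) / Real.tanh t := by
    rw [jacobiDrift, jacobiRho]; field_simp; ring
  have : 0 ≤ (1 - Real.tanh t) * ((2 * α + 1) - (2 * β + 1) * Real.tanh t) / Real.tanh t := by
    refine div_nonneg (mul_nonneg (by linarith) ?_) h0.le
    nlinarith
  linarith

theorem antitoneOn_jacobi_energy {α β : ℝ} (hβα : β ≤ α) (hβ : -(1 / 2 : ℝ) ≤ β)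
    (hα : -(1 / 2 : ℝ) < α) (lam : ℝ) :
    AntitoneOn (fun t => ‖jacobiPhiDeriv α β lam t + jacobiRho α β * jacobiPhi α β lam t‖ ^ 2
      + (lam ^ 2 - jacobiRho α β ^ 2 + jacobiRho α β * jacobiDrift α β t) *
        ‖jacobiPhi α β lam t‖ ^ 2) (Set.Ioi 0) := by
  refine antitoneOn_energy (by rw [jacobiRho]; linarith)
    (fun t _ => hasDerivAt_jacobiPhi β (by linarith) lam t)
    (fun t ht => hasDerivAt_jacobiPhiDeriv β (by linarith) lam ht)
    (fun t ht => hasDerivAt_jacobiDrift α β ht)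
    (fun t ht => two_mul_jacobiRho_le_jacobiDrift hβα hα ht) (fun t ht => ?_)
  have h0 := Real.tanh_pos_of_pos ht
  have h1 := Real.tanh_sq_lt_one t
  refine mul_nonpos_of_nonpos_of_nonneg ?_ (by linarith)
  rw [sub_nonpos, le_div_iff₀ (by positivity)]
  nlinarith [sq_nonneg (Real.tanh t)]

/-! ### Power series bounds near `t = 0`. -/

/-- In the ratio `(a+n)(b+n)/((n+1)(c+n))` each numerator factor is at most `L(n+1)`, and `c + n ≥
(n+1)/2`, so consecutive coefficients grow by at most `2L²`. -/
theorem norm_coeff_le_pow {a b : ℂ} {c L : ℝ} (hc : 1 / 2 ≤ c) (hL : 1 ≤ L) (ha : ‖a‖ ≤ L)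
    (hb : ‖b‖ ≤ L) (n : ℕ) : ‖coeff a b c n‖ ≤ (2 * L ^ 2) ^ n := by
  have hc' : ∀ k : ℕ, (c : ℂ) ≠ -k := fun k h => by
    have h' : c = -k := by exact_mod_cast h
    have : (0 : ℝ) ≤ k := k.cast_nonneg
    linarith
  induction n with
  | zero => simp [coeff_zero]
  | succ n ih =>
    have h := congrArg norm (coeff_succ a b hc' n)
    have hn : (0 : ℝ) ≤ n := n.cast_nonneg
    have h1 : ‖(n : ℂ) + 1‖ = n + 1 := by
      rw [← Nat.cast_succ, Complex.norm_natCast]; push_cast; ring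
    have h2 : ‖(c : ℂ) + n‖ = c + n := by
      rw [← Complex.ofReal_natCast, ← Complex.ofReal_add, Complex.norm_real,
        Real.norm_of_nonneg (by linarith)]
    have bd (w : ℂ) (hw : ‖w‖ ≤ L) : ‖w + n‖ ≤ L * (n + 1) := by
      refine (norm_add_le _ _).trans ?_
      rw [Complex.norm_natCast]
      nlinarith
    rw [norm_mul, norm_mul, norm_mul, norm_mul, h1, h2] at h
    have h3 : (n + 1) * (c + n) * ‖coeff a b c (n + 1)‖
        ≤ (L * (n + 1)) * (L * (n + 1)) * (2 * L ^ 2) ^ n := by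
      rw [h]
      gcongr
      · exact bd a ha
      · exact bd b hb
    have h4 : (n + 1) * ((n + 1) / 2) * ‖coeff a b c (n + 1)‖
        ≤ (n + 1) * (c + n) * ‖coeff a b c (n + 1)‖ := by
      gcongr
      linarith
    have h5 : (0 : ℝ) < (n + 1) * ((n + 1) / 2) := by positivity
    refine le_of_mul_le_mul_left ((h4.trans h3).trans (le_of_eq ?_)) h5
    ring

theorem norm_hyp_le_two {a b : ℂ} {c L y : ℝ} (hc : 1 / 2 ≤ c) (hL : 1 ≤ L) (ha : ‖a‖ ≤ L)
    (hb : ‖b‖ ≤ L) (hy0 : 0 ≤ y) (hy : 2 * L ^ 2 * y ≤ 1 / 2) :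
    ‖ordinaryHypergeometric a b (c : ℂ) (y : ℂ)‖ ≤ 2 := by
  rw [hyp_eq_tsum]
  refine tsum_of_norm_bounded hasSum_geometric_two fun n => ?_
  rw [norm_mul, norm_pow, Complex.norm_real, Real.norm_of_nonneg hy0]
  calc ‖coeff a b c n‖ * y ^ n ≤ (2 * L ^ 2) ^ n * y ^ n := by
        gcongr; exact norm_coeff_le_pow hc hL ha hb n
    _ ≤ (1 / 2) ^ n := by rw [← mul_pow]; gcongr

theorem norm_hyp_deriv_le {a b : ℂ} {c L y : ℝ} (hc : 1 / 2 ≤ c) (hL : 1 ≤ L) (ha : ‖a‖ ≤ L)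
    (hb : ‖b‖ ≤ L) (hy0 : 0 ≤ y) (hy : 2 * L ^ 2 * y ≤ 1 / 2) :
    ‖a * b / c * ordinaryHypergeometric (a + 1) (b + 1) ((c : ℂ) + 1) (y : ℂ)‖ ≤ 8 * L ^ 2 := by
  have hc' : ∀ k : ℕ, (c : ℂ) ≠ -k := fun k h => by
    have h' : c = -k := by exact_mod_cast h
    have : (0 : ℝ) ≤ k := k.cast_nonneg
    linarith
  -- Here `∑ n/2ⁿ = ∑ 1/2ⁿ = 2`, whence `2L² · 4`.
  have hs : HasSum (fun n : ℕ => 2 * L ^ 2 * ((n : ℝ) * (1 / 2) ^ n + (1 / 2) ^ n)) (8 * L ^ 2) := by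
    have h := ((hasSum_coe_mul_geometric_of_norm_lt_one (r := (1 / 2 : ℝ)) (by norm_num)).add
      hasSum_geometric_two).mul_left (2 * L ^ 2)
    convert! h using 1
    norm_num
    ring
  rw [hyp_eq_tsum, ← tsum_mul_left]
  refine tsum_of_norm_bounded hs fun n => ?_
  have e : a * b / c * (coeff (a + 1) (b + 1) (c + 1) n * (y : ℂ) ^ n)
      = ((n + 1 : ℕ) : ℂ) * coeff a b c (n + 1) * (y : ℂ) ^ n := by
    have := coeff_succ_shift a b hc' n
    push_cast
    linear_combination -(y : ℂ) ^ n * this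
  rw [e, norm_mul, norm_mul, norm_pow, Complex.norm_real, Real.norm_of_nonneg hy0,
    Complex.norm_natCast]
  calc ((n + 1 : ℕ) : ℝ) * ‖coeff a b c (n + 1)‖ * y ^ n
      ≤ ((n + 1 : ℕ) : ℝ) * (2 * L ^ 2) ^ (n + 1) * y ^ n := by
        gcongr; exact norm_coeff_le_pow hc hL ha hb _
    _ = ((n + 1 : ℕ) : ℝ) * (2 * L ^ 2) * (2 * L ^ 2 * y) ^ n := by rw [mul_pow, pow_succ]; ring
    _ ≤ ((n + 1 : ℕ) : ℝ) * (2 * L ^ 2) * (1 / 2) ^ n := by gcongr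
    _ = _ := by push_cast; ring

theorem norm_exp_I_mul_mul (lam x : ℝ) : ‖Complex.exp (Complex.I * lam * x)‖ = 1 := by
  rw [mul_assoc, ← Complex.ofReal_mul, mul_comm, Complex.norm_exp_ofReal_mul_I]

theorem norm_jacobiPhi (α β lam t : ℝ) :
    ‖jacobiPhi α β lam t‖ = ‖jacobiFactor α β (Real.tanh t ^ 2) (Complex.I * lam)‖ := by
  rw [jacobiPhi, norm_mul, norm_exp_I_mul_mul, one_mul]

theorem norm_neg_I_mul_div_two_le {β lam L : ℝ} (hL : 1 + |β| + |lam| ≤ L) :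
    ‖-(Complex.I * (lam : ℂ)) / 2‖ ≤ L ∧ ‖-(β : ℂ) - Complex.I * lam / 2‖ ≤ L := by
  have hlam := abs_nonneg lam
  have hβ0 := abs_nonneg β
  have h : ‖Complex.I * (lam : ℂ) / 2‖ = |lam| / 2 := by simp
  constructor
  · rw [neg_div, norm_neg, h]; linarith
  · refine (norm_sub_le _ _).trans ?_
    rw [h, norm_neg, Complex.norm_real, Real.norm_eq_abs]; linarith

theorem norm_jacobiFactor_le_two {α β lam L y : ℝ} (hα : -(1 / 2 : ℝ) < α)
    (hL : 1 + |β| + |lam| ≤ L) (hy0 : 0 ≤ y) (hy : 2 * L ^ 2 * y ≤ 1 / 2) :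
    ‖jacobiFactor α β y (Complex.I * lam)‖ ≤ 2 := by
  obtain ⟨ha, hb⟩ := norm_neg_I_mul_div_two_le hL
  have := norm_hyp_le_two (c := α + 1) (by linarith)
    (by linarith [abs_nonneg β, abs_nonneg lam]) ha hb hy0 hy
  push_cast at this
  exact this

theorem norm_jacobiFactorDeriv_le {α β lam L y : ℝ} (hα : -(1 / 2 : ℝ) < α)
    (hL : 1 + |β| + |lam| ≤ L) (hy0 : 0 ≤ y) (hy : 2 * L ^ 2 * y ≤ 1 / 2) :
    ‖jacobiFactorDeriv α β y (Complex.I * lam)‖ ≤ 8 * L ^ 2 := by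
  obtain ⟨ha, hb⟩ := norm_neg_I_mul_div_two_le hL
  have := norm_hyp_deriv_le (c := α + 1) (by linarith)
    (by linarith [abs_nonneg β, abs_nonneg lam]) ha hb hy0 hy
  push_cast at this
  exact this

/-- The threshold `1/(2L)` gives `2L² tanh² t ≤ 1/2`, so the series is dominated by a geometric one
of ratio `1/2`. -/
theorem norm_jacobiPhiDeriv_le {α β lam L t : ℝ} (hα : -(1 / 2 : ℝ) < α)
    (hL : 1 + |β| + |lam| ≤ L) (ht0 : 0 ≤ Real.tanh t) (ht : Real.tanh t ≤ 1 / (2 * L)) :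
    ‖jacobiPhi α β lam t‖ ≤ 2 ∧ ‖jacobiPhiDeriv α β lam t‖ ≤ 10 * L ^ 2 := by
  have hlam := abs_nonneg lam
  have hβ0 := abs_nonneg β
  have hL1 : 1 ≤ L := by linarith
  have hlL : |lam| ≤ L := by linarith
  have hy : 2 * L ^ 2 * Real.tanh t ^ 2 ≤ 1 / 2 := by
    calc 2 * L ^ 2 * Real.tanh t ^ 2 ≤ 2 * L ^ 2 * (1 / (2 * L)) ^ 2 := by gcongr
      _ = 1 / 2 := by field_simp
  have hF := norm_jacobiFactor_le_two hα hL (sq_nonneg _) hy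
  have hF1 := norm_jacobiFactorDeriv_le hα hL (sq_nonneg _) hy
  refine ⟨by rwa [norm_jacobiPhi], ?_⟩
  rw [jacobiPhiDeriv, norm_mul, norm_exp_I_mul_mul, one_mul]
  have hτ1 : Real.tanh t ≤ 1 / 2 :=
    ht.trans (one_div_le_one_div_of_le two_pos (by linarith))
  generalize Real.tanh t = τ at *
  generalize jacobiFactor α β (τ ^ 2) (Complex.I * lam) = F at *
  generalize jacobiFactorDeriv α β (τ ^ 2) (Complex.I * lam) = F₁ at *
  refine (norm_add_le _ _).trans ?_
  have e : (2 : ℂ) * τ * (1 - τ ^ 2) = ((2 * τ * (1 - τ ^ 2) : ℝ) : ℂ) := by push_cast; ring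
  have hsq : τ ^ 2 ≤ 1 := by nlinarith
  have e2 : 0 ≤ 2 * τ * (1 - τ ^ 2) := mul_nonneg (by linarith) (by linarith)
  have e3 : 2 * τ * (1 - τ ^ 2) ≤ 1 := by nlinarith [sq_nonneg τ]
  rw [e, norm_mul, norm_mul, norm_mul, norm_mul, Complex.norm_I, Complex.norm_real,
    Complex.norm_real, Complex.norm_real, Real.norm_of_nonneg ht0, Real.norm_of_nonneg e2,
    Real.norm_eq_abs]
  calc 1 * |lam| * τ * ‖F‖ + 2 * τ * (1 - τ ^ 2) * ‖F₁‖ ≤ 1 * L * 1 * 2 + 1 * (8 * L ^ 2) := by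
        gcongr
        linarith
    _ ≤ 10 * L ^ 2 := by nlinarith

/-! ### Energy at the starting point and growth in `lam`. -/

theorem jacobiDrift_le {α β L t : ℝ} (hβ : -(1 / 2 : ℝ) ≤ β) (hα : -(1 / 2 : ℝ) < α)
    (hL : 1 ≤ L) (ht : Real.tanh t = 1 / (2 * L)) :
    jacobiDrift α β t ≤ (4 * α + 2 * β + 3) * L ^ 2 := by
  have e : jacobiDrift α β t = (2 * α + 1) * (2 * L) + (2 * β + 1) * (1 / (2 * L)) := by
    rw [jacobiDrift, ht]; field_simp
  have h1 : 0 ≤ 2 * α + 1 := by linarith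
  have h2 : 0 ≤ 2 * β + 1 := by linarith
  have h3 : L ≤ L ^ 2 := by nlinarith
  have h4 : 1 / (2 * L) ≤ L ^ 2 := by
    rw [div_le_iff₀ (by positivity)]; nlinarith [sq_nonneg L]
  rw [e]
  calc (2 * α + 1) * (2 * L) + (2 * β + 1) * (1 / (2 * L))
      ≤ (2 * α + 1) * (2 * L ^ 2) + (2 * β + 1) * L ^ 2 := by gcongr
    _ = _ := by ring

/-- Extracts the square root of the energy inequality: `x` is `|φ|` at the later time, `W`, `P`, `q`
the data at the starting time. Since `(4+4b)L² ≥ 1`, it is at most its own square, and `X² + Y² ≤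
(X+Y)²` finishes. -/
theorem mul_abs_le_of_energy_le {x lam W P q a b L : ℝ} (ha : 0 ≤ a) (hb : 0 ≤ b) (hL : 1 ≤ L)
    (h : lam ^ 2 * x ^ 2 ≤ W ^ 2 + q * P ^ 2) (hW : W ≤ a * L ^ 2) (hW0 : 0 ≤ W) (hP0 : 0 ≤ P)
    (hP : P ≤ 2) (hq : q ≤ (1 + b) * L ^ 2) :
    x * |lam| ≤ (a + (4 + 4 * b)) * L ^ 2 := by
  have hL2 : 1 ≤ L ^ 2 := one_le_pow₀ hL
  have h1 : W ^ 2 ≤ (a * L ^ 2) ^ 2 := by gcongr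
  have h2 : q * P ^ 2 ≤ (1 + b) * L ^ 2 * 2 ^ 2 := by
    calc q * P ^ 2 ≤ (1 + b) * L ^ 2 * P ^ 2 := by gcongr
      _ ≤ _ := by gcongr
  have h3 : (1 + b) * L ^ 2 * 2 ^ 2 ≤ ((4 + 4 * b) * L ^ 2) ^ 2 := by
    have : 1 ≤ (4 + 4 * b) * L ^ 2 := one_le_mul_of_one_le_of_one_le (by linarith) hL2
    calc (1 + b) * L ^ 2 * 2 ^ 2 = (4 + 4 * b) * L ^ 2 := by ring
      _ ≤ _ := le_self_pow₀ this two_ne_zero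
  have h4 : 0 ≤ a * L ^ 2 * ((4 + 4 * b) * L ^ 2) := by positivity
  refine le_of_sq_le_sq ?_ (by positivity)
  rw [mul_pow, sq_abs]
  linarith

/-- Polynomial growth in `lam` of the Jacobi function, uniformly in `t`. -/
theorem exists_norm_jacobiPhi_mul_abs_le {α β : ℝ} (hβα : β ≤ α) (hβ : -(1 / 2 : ℝ) ≤ β)
    (hα : -(1 / 2 : ℝ) < α) :
    ∃ K : ℝ, 0 < K ∧ ∀ t : ℝ, 0 ≤ t → ∀ lam : ℝ,
      ‖jacobiPhi α β lam t‖ * |lam| ≤ K * (1 + |β| + |lam|) ^ 2 := by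
  set ρ := jacobiRho α β with hρ
  have hρ0 : 0 < ρ := by rw [hρ, jacobiRho]; linarith
  have hA : 0 ≤ 4 * α + 2 * β + 3 := by linarith
  set K := (10 + 2 * ρ) + (4 + 4 * (ρ * (4 * α + 2 * β + 3))) with hK
  have hK1 : 0 ≤ ρ * (4 * α + 2 * β + 3) := by positivity
  refine ⟨K, by linarith, fun t ht lam => ?_⟩
  have hlam := abs_nonneg lam
  have hβ0 := abs_nonneg β
  obtain ⟨L, hL⟩ : ∃ L, L = 1 + |β| + |lam| := ⟨_, rfl⟩
  have hL1 : 1 ≤ L := by linarith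
  have hlL : |lam| ≤ L := by linarith
  rw [← hL]
  have hL2 : L ≤ L ^ 2 := by nlinarith
  rcases le_or_gt (Real.tanh t) (1 / (2 * L)) with hτ | hτ
  · have h0 : 0 ≤ Real.tanh t := by
      rw [Real.tanh_eq_sinh_div_cosh]
      exact div_nonneg (Real.sinh_nonneg_iff.2 ht) (Real.cosh_pos t).le
    have h := (norm_jacobiPhiDeriv_le hα hL.ge h0 hτ).1
    calc _ ≤ 2 * L ^ 2 := by gcongr; exact hlL.trans hL2
      _ ≤ K * L ^ 2 := by gcongr; linarith
  have hτ0 : 0 < 1 / (2 * L) := by positivity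
  have hτ1 : 1 / (2 * L) ≤ 1 / 2 := one_div_le_one_div_of_le two_pos (by linarith)
  -- The energy cannot start at `0`, where the drift blows up; `s` is the last point at which the
  -- series bounds apply, and there the drift is only of order `L`.
  obtain ⟨s, hs⟩ : ∃ s, s = Real.artanh (1 / (2 * L)) := ⟨_, rfl⟩
  have hT : Real.tanh s = 1 / (2 * L) := by
    rw [hs]; exact Real.tanh_artanh ⟨by linarith, by linarith⟩
  have hs0 : 0 < s := by rw [hs]; exact Real.artanh_pos ⟨hτ0, by linarith⟩
  have hst : s ≤ t := by
    rw [hs, ← Real.artanh_tanh t]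
    exact Real.artanh_le_artanh (by linarith) (Real.tanh_lt_one t) hτ.le
  have hE := antitoneOn_jacobi_energy hβα hβ hα lam (Set.mem_Ioi.2 hs0)
    (Set.mem_Ioi.2 (hs0.trans_le hst)) hst
  obtain ⟨hP, hP1⟩ := norm_jacobiPhiDeriv_le hα hL.ge (by rw [hT]; exact hτ0.le) hT.le
  have hp := jacobiDrift_le hβ hα hL1 hT
  have hp1 := two_mul_jacobiRho_le_jacobiDrift hβα hα (hs0.trans_le hst)
  have hp2 := two_mul_jacobiRho_le_jacobiDrift hβα hα hs0
  simp only [← hρ] at hE hp1 hp2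
  have hW : ‖jacobiPhiDeriv α β lam s + ρ * jacobiPhi α β lam s‖ ≤ (10 + 2 * ρ) * L ^ 2 := by
    refine (norm_add_le _ _).trans ?_
    rw [norm_mul, Complex.norm_real, Real.norm_of_nonneg hρ0.le]
    have := mul_le_mul_of_nonneg_left hP hρ0.le
    nlinarith
  have hl2 : lam ^ 2 ≤ L ^ 2 := by rw [← sq_abs]; gcongr
  have e0 := mul_le_mul_of_nonneg_left hp hρ0.le
  have e1 := mul_le_mul_of_nonneg_left hp1 hρ0.le
  have hq : lam ^ 2 - ρ ^ 2 + ρ * jacobiDrift α β s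
      ≤ (1 + ρ * (4 * α + 2 * β + 3)) * L ^ 2 := by
    linarith [sq_nonneg ρ]
  -- Since `ρp ≥ 2ρ² ≥ ρ²`, the energy at `t` is at least `lam² ‖φ‖²`.
  have hqt : lam ^ 2 ≤ lam ^ 2 - ρ ^ 2 + ρ * jacobiDrift α β t := by
    linarith [sq_nonneg ρ]
  refine mul_abs_le_of_energy_le (by linarith) hK1 hL1 ?_ hW (norm_nonneg _) (norm_nonneg _)
    hP hq
  refine le_trans ?_ hE
  have := mul_le_mul_of_nonneg_right hqt (sq_nonneg ‖jacobiPhi α β lam t‖)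
  linarith [sq_nonneg ‖jacobiPhiDeriv α β lam t + ρ * jacobiPhi α β lam t‖]

end Hyp

/-! ### The first moment and the final estimate. -/

theorem hasDerivAt_jacobiFunction {α β : ℝ} (hα : -1 < α) {t D : ℝ}
    (hD : HasDerivAt (Hyp.jacobiFactor α β (Real.tanh t ^ 2)) D 0) :
    HasDerivAt (fun s : ℝ => jacobiFunction α β (Complex.I * jacobiRho α β + Complex.I * s) t)
      ((Real.log (Real.cosh t) + D : ℝ) : ℂ) 0 := by
  have e : (fun s : ℝ => jacobiFunction α β (Complex.I * jacobiRho α β + Complex.I * s) t)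
      = fun s : ℝ => Complex.exp ((s : ℂ) * Real.log (Real.cosh t)) *
        Hyp.jacobiFactor α β (Real.tanh t ^ 2) s :=
    funext fun s => jacobiFunction_eq_exp_mul_hyp hα s t
  rw [e]
  have h1 : HasDerivAt (fun z : ℂ => Complex.exp (z * Real.log (Real.cosh t)) *
      Hyp.jacobiFactor α β (Real.tanh t ^ 2) z)
      ((Real.log (Real.cosh t) + D : ℝ) : ℂ) ((0 : ℝ) : ℂ) := by
    rw [Complex.ofReal_zero]
    convert! (((hasDerivAt_id (0 : ℂ)).mul_const (Real.log (Real.cosh t) : ℂ)).cexp).mul hD using 1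
    simp [Hyp.jacobiFactor_zero]
  exact h1.comp_ofReal

/-- The common phase `exp(i lam log cosh t)` factors out; only quantities bounded uniformly in `t`
for small `lam` remain. -/
theorem norm_jacobiFunction_sub_exp {α β : ℝ} (hα : -1 < α) (t D lam : ℝ) :
    ‖jacobiFunction α β (Complex.I * jacobiRho α β - lam) t
        - Complex.exp (Complex.I * lam * ((Real.log (Real.cosh t) + D : ℝ) : ℂ))‖
      = ‖Hyp.jacobiFactor α β (Real.tanh t ^ 2) (Complex.I * lam)
        - Complex.exp (Complex.I * lam * D)‖ := by
  have e : Complex.I * (jacobiRho α β : ℂ) - lam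
      = Complex.I * jacobiRho α β + Complex.I * (Complex.I * lam) := by
    linear_combination (-(lam : ℂ)) * Complex.I_mul_I
  rw [e, jacobiFunction_eq_exp_mul_hyp hα, Complex.ofReal_add, mul_add, Complex.exp_add, ← mul_sub,
    norm_mul, Hyp.norm_exp_I_mul_mul, one_mul]
  rfl

theorem mainTheorem6 (α β : ℝ) (hβα : β ≤ α) (hβ : -(1 / 2 : ℝ) ≤ β) (hα : -(1 / 2 : ℝ) < α) :
    (∀ t : ℝ, 0 ≤ t →
      DifferentiableAt ℝ
        (fun s : ℝ => jacobiFunction α β (Complex.I * jacobiRho α β + Complex.I * s) t) 0) ∧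
    ∃ C : ℝ, ∀ t : ℝ, 0 ≤ t → ∀ lam : ℝ,
      ‖jacobiFunction α β (Complex.I * jacobiRho α β - lam) t
          - Complex.exp (Complex.I * lam * momentFunction α β 1 t)‖
        ≤ C * (lam ^ 2 + |lam| ^ 3) := by
  have hα' : -1 < α := by linarith
  obtain ⟨r, K, hr, hK, hsmall⟩ := Hyp.exists_forall_norm_jacobiFactor_sub_le hβα hβ hα
  obtain ⟨K', hK', hlarge⟩ := Hyp.exists_norm_jacobiPhi_mul_abs_le hβα hβ hα
  have hy (t : ℝ) := hsmall (Real.tanh t ^ 2) (sq_nonneg _) (Real.tanh_sq_lt_one t)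
  refine ⟨fun t _ => ?_, ?_⟩
  · obtain ⟨D, -, hD, -⟩ := hy t
    exact (hasDerivAt_jacobiFunction hα' hD).differentiableAt
  -- Below `r` the expansion of the factor holds; below `1/K` one has `|lam D| ≤ 1`, as the second
  -- order bound for `exp` requires.
  set δ := min r (1 / K) with hδ
  have hδ0 : 0 < δ := lt_min hr (by positivity)
  -- Chosen so that `1 + |β| + |lam| ≤ m |lam|` once `|lam| ≥ δ`.
  set m := (1 + |β|) / δ + 1 with hm
  have hβ0 := abs_nonneg β
  have hm0 : 0 < m := by positivity
  refine ⟨(K + K ^ 2) + (K' * m ^ 2 / δ + 1 / δ ^ 2), fun t ht lam => ?_⟩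
  obtain ⟨D, hDK, hD, hDz⟩ := hy t
  have hm1 : momentFunction α β 1 t = ((Real.log (Real.cosh t) + D : ℝ) : ℂ) := by
    rw [momentFunction, iteratedDeriv_one]
    exact (hasDerivAt_jacobiFunction hα' hD).deriv
  rw [hm1, norm_jacobiFunction_sub_exp hα']
  have hn : ‖Complex.I * (lam : ℂ)‖ = |lam| := by simp
  have hlam := abs_nonneg lam
  have hsq := sq_nonneg lam
  have hA : 0 ≤ K + K ^ 2 := by positivity
  have hB : 0 ≤ K' * m ^ 2 / δ + 1 / δ ^ 2 := by positivity
  suffices h : ‖Hyp.jacobiFactor α β (Real.tanh t ^ 2) (Complex.I * lam)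
      - Complex.exp (Complex.I * lam * D)‖ ≤ (K + K ^ 2) * lam ^ 2 ∨
      ‖Hyp.jacobiFactor α β (Real.tanh t ^ 2) (Complex.I * lam)
      - Complex.exp (Complex.I * lam * D)‖ ≤ (K' * m ^ 2 / δ + 1 / δ ^ 2) * lam ^ 2 by
    have h3 : 0 ≤ |lam| ^ 3 := by positivity
    have := mul_nonneg (add_nonneg hA hB) h3
    have := mul_nonneg hA hsq
    have := mul_nonneg hB hsq
    rcases h with h | h <;> linarith
  rcases lt_or_ge |lam| δ with hl | hl
  · left
    have h1 := hDz (Complex.I * lam) (by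
      rw [mem_ball_zero_iff, hn]; exact hl.trans_le (min_le_left _ _))
    have hlD : ‖Complex.I * (lam : ℂ) * D‖ = |lam| * |D| := by simp
    have hlK : |lam| * |D| ≤ |lam| * K := by gcongr
    have h2 := Complex.norm_exp_sub_one_sub_id_le (x := Complex.I * lam * D) (by
      rw [hlD]
      refine hlK.trans ?_
      rw [← le_div_iff₀ hK]
      exact hl.le.trans (min_le_right _ _))
    rw [hn, sq_abs] at h1
    rw [hlD] at h2
    have h3 : (|lam| * |D|) ^ 2 ≤ K ^ 2 * lam ^ 2 := by
      calc (|lam| * |D|) ^ 2 ≤ (|lam| * K) ^ 2 := by gcongr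
        _ = K ^ 2 * lam ^ 2 := by rw [mul_pow, sq_abs]; ring
    have e : Hyp.jacobiFactor α β (Real.tanh t ^ 2) (Complex.I * lam)
        - Complex.exp (Complex.I * lam * D)
        = (Hyp.jacobiFactor α β (Real.tanh t ^ 2) (Complex.I * lam) - 1 - D * (Complex.I * lam))
          - (Complex.exp (Complex.I * lam * D) - 1 - Complex.I * lam * D) := by ring
    rw [e]
    refine (norm_sub_le _ _).trans ?_
    linarith
  · right
    have hl0 : 0 < |lam| := hδ0.trans_le hl
    have h1 := hlarge t ht lam
    rw [Hyp.norm_jacobiPhi] at h1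
    have h2 : 1 + |β| + |lam| ≤ m * |lam| := by
      have : 1 + |β| ≤ (1 + |β|) / δ * |lam| := by
        rw [div_mul_eq_mul_div, le_div_iff₀ hδ0]; gcongr
      rw [hm]; linarith
    have h3 : ‖Hyp.jacobiFactor α β (Real.tanh t ^ 2) (Complex.I * lam)‖ ≤ K' * m ^ 2 * |lam| := by
      refine le_of_mul_le_mul_right (h1.trans ?_) hl0
      calc K' * (1 + |β| + |lam|) ^ 2 ≤ K' * (m * |lam|) ^ 2 := by gcongr
        _ = _ := by ring
    -- For `|lam| ≥ δ` both the linear growth of the factor and the modulus one of the exponential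
    -- are absorbed into `lam²`.
    have h4 : |lam| ≤ lam ^ 2 / δ := by
      rw [le_div_iff₀ hδ0, ← sq_abs, sq]; gcongr
    have h5 : 1 ≤ lam ^ 2 / δ ^ 2 := by
      rw [le_div_iff₀ (by positivity), one_mul, ← sq_abs lam]; gcongr
    refine (norm_sub_le _ _).trans ?_
    rw [Hyp.norm_exp_I_mul_mul]
    calc _ ≤ K' * m ^ 2 * (lam ^ 2 / δ) + lam ^ 2 / δ ^ 2 :=
          add_le_add (h3.trans (by gcongr)) h5
      _ = _ := by ring
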